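/- **Theorem 1.1 (Second order infinite-dimensional Poincaré inequality).** Let $\mathfrak H$ be a real separable Hilbert space and let $X=\{X(h):h\in\mathfrak H\}$ be an isonormal Gaussian process over $\mathfrak H$ on a probability space $(\Omega,\mathcal F,P)$, that is, a centered Gaussian family with $E[X(h)X(g)]=\langle h,g\rangle_{\mathfrak H}$ for all $h,g\in\mathfrak H$. For a cylindrical random variable $G=g(X(\phi_1),\dots,X(\phi_n))$, with $g:\mathbb R^n\to\mathbb R$ infinitely differentiable with compact support and $\phi_1,\dots,\phi_n\in\mathfrak H$, put $$DG=\sum_{i}\partial_i g(X(\phi_1),\dots,X(\phi_n))\,\phi_i,\qquad D^2G=\sum_{i,j}\partial_i\partial_j g(X(\phi_1),\dots,X(\phi_n))\,\phi_i\otimes\phi_j ,$$ random elements of $\mathfrak H$ and of the Hilbert tensor product $\mathfrak H\otimes\mathfrak H$. Let $\mathbb D^{2,4}$ be the closure of the set of cylindrical random variables with respect to the norm $\|G\|_{2,4}$ given by $\|G\|_{2,4}^4=E|G|^4+E\|DG\|_{\mathfrak H}^4+E\|D^2G\|_{\mathfrak H\otimes\mathfrak H}^4$, and for $F\in\mathbb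 D^{2,4}$ let $DF$, $D^2F$ denote the (first and second) Malliavin derivatives of $F$, obtained as the corresponding $L^4$-limits. Let $\|D^2F\|_{op}$ be the operator norm of the random Hilbert–Schmidt operator $\mathfrak H\to\mathfrak H$, $f\mapsto\langle f,D^2F\rangle_{\mathfrak H}$, where $\langle f,a\otimes b\rangle_{\mathfrak H}=\langle f,a\rangle_{\mathfrak H}\,b$. Let $F\in\mathbb D^{2,4}$ with $E(F)=\mu$ and $\mathrm{Var}(F)=\sigma^2$, where $\sigma>0$, and let $Z\sim\mathcal N(\mu,\sigma^2)$. Then $$d_W(F,Z)\le\frac{\sqrt{10}}{2\sigma}\,E\big[\|D^2F\|_{op}^4\big]^{1/4}\,E\big[\|DF\|_{\mathfrak H}^4\big]^{1/4},$$ where $d_W(F,Z)=\sup\{|E[f(F)]-E[f(Z)]| : f:\mathbb R\to\mathbb R,\ |f(x)-f(y)|\le|x-y| \text{ for all } x,y\}$. If, in addition, the law of $F$ is absolutely continuous with respect to the Lebesgue measure, then $$d_{TV}(F,Z)\le\frac{\sqrt{10}}{\sigma^2}\,E\big[\|D^2F\|_{op}^4\big]^{1/4}\,E\big[\|DF\|_{\mathfrak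 H}^4\big]^{1/4},$$ where $d_{TV}(F,Z)=\sup_A|P(F\in A)-P(Z\in A)|$, the supremum being over all Borel sets $A\subseteq\mathbb R$. -/

import Mathlib

open MeasureTheory ProbabilityTheory Filter Topology
open scoped ENNReal NNReal TensorProduct InnerProductSpace

noncomputable section

namespace Malliavin

/-- `X = {X(h) : h ∈ H}` is an isonormal Gaussian process over the real Hilbert space `H`: a centred
Gaussian family with covariance `E[X(h) X(g)] = ⟨h, g⟩`. -/
structure IsIsonormal {H Ω : Type*} [NormedAddCommGroup H] [InnerProductSpace ℝ H]
    [MeasurableSpace Ω] (X : H → Ω → ℝ) (P : Measure Ω) : Prop where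
  gaussian : IsGaussianProcess X P
  centered : ∀ h : H, ∫ ω, X h ω ∂P = 0
  covariance : ∀ h g : H, ∫ ω, X h ω * X g ω ∂P = ⟪h, g⟫_ℝ

/-- The Hilbert tensor product `H ⊗ H`: the completion of the algebraic tensor product for the
inner product with `⟨a ⊗ b, c ⊗ d⟩ = ⟨a, c⟩ ⟨b, d⟩`. -/
abbrev HTensor (H : Type*) [NormedAddCommGroup H] [InnerProductSpace ℝ H] : Type _ :=
  UniformSpace.Completion (H ⊗[ℝ] H)

/-- The elementary tensor `a ⊗ b` in the Hilbert tensor product. -/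
def tmulH {H : Type*} [NormedAddCommGroup H] [InnerProductSpace ℝ H] (a b : H) : HTensor H :=
  ((a ⊗ₜ[ℝ] b : H ⊗[ℝ] H) : UniformSpace.Completion (H ⊗[ℝ] H))

/-- The Hilbert-Schmidt operator `f ↦ ⟨f, T⟩_H` on `H` associated with `T ∈ H ⊗ H`, that is,
the operator `A` with `⟨A f, g⟩ = ⟨T, f ⊗ g⟩` for all `f, g ∈ H` (Riesz representation). It sends
`a ⊗ b` to `f ↦ ⟨f, a⟩ b`. -/
def contractOp {H : Type*} [NormedAddCommGroup H] [InnerProductSpace ℝ H] [CompleteSpace H]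
    (T : HTensor H) : H →L[ℝ] H :=
  InnerProductSpace.continuousLinearMapOfBilin (𝕜 := ℝ)
    ((ContinuousLinearMap.compL ℝ H (H ⊗[ℝ] H) ℝ
      ((innerSL ℝ T).comp UniformSpace.Completion.toComplL)).comp (TensorProduct.mkL ℝ H H))

/-- The partial derivative `∂g/∂xᵢ` of a function of `n` real variables. -/
def partialDeriv {n : ℕ} (i : Fin n) (g : (Fin n → ℝ) → ℝ) (x : Fin n → ℝ) : ℝ :=
  fderiv ℝ g x (Pi.single i 1)

/-- The data of a cylindrical random variable `g(X(φ₁), …, X(φₙ))`, with `g` smooth and compactly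
supported. (For `n = 0` it is a constant, which is also obtained with `n = 1` and `φ₁ = 0`.) -/
structure Cylinder (H : Type*) where
  n : ℕ
  g : (Fin n → ℝ) → ℝ
  φ : Fin n → H
  smooth : ContDiff ℝ ((⊤ : ℕ∞) : WithTop ℕ∞) g
  compact : HasCompactSupport g

namespace Cylinder

variable {H Ω : Type*} [NormedAddCommGroup H] [InnerProductSpace ℝ H]

/-- The random vector `(X(φ₁), …, X(φₙ))`. -/
def vec (G : Cylinder H) (X : H → Ω → ℝ) (ω : Ω) : Fin G.n → ℝ := fun i ↦ X (G.φ i) ω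

/-- The random variable `g(X(φ₁), …, X(φₙ))`. -/
def val (G : Cylinder H) (X : H → Ω → ℝ) (ω : Ω) : ℝ := G.g (G.vec X ω)

/-- Its Malliavin derivative `∑ᵢ ∂ᵢg(X(φ₁), …, X(φₙ)) φᵢ`. -/
def D (G : Cylinder H) (X : H → Ω → ℝ) (ω : Ω) : H :=
  ∑ i, partialDeriv i G.g (G.vec X ω) • G.φ i

/-- Its second Malliavin derivative `∑ᵢⱼ ∂ᵢ∂ⱼg(X(φ₁), …, X(φₙ)) φᵢ ⊗ φⱼ`. -/
def D2 (G : Cylinder H) (X : H → Ω → ℝ) (ω : Ω) : HTensor H :=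
  ∑ i, ∑ j, partialDeriv i (partialDeriv j G.g) (G.vec X ω) • tmulH (G.φ i) (G.φ j)

end Cylinder

/-- For `1 ≤ p < ∞`: `F` belongs to `𝔻^{2,p}`, with first and second Malliavin derivatives `DF` and `D2F` (as
`L^p`-random elements of `H` and `H ⊗ H`, determined up to null sets): there are cylindrical random
variables `Gₖ` with `Gₖ → F`, `D Gₖ → DF` and `D² Gₖ → D2F` in `L^p`. In other words, `F` is in the
closure of the cylindrical random variables for
`‖F‖_{2,p}^p = E|F|^p + E‖DF‖^p + E‖D²F‖^p`, and `DF`, `D2F` are the limits of the derivatives. -/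
structure IsMalliavin2 {H Ω : Type*} [NormedAddCommGroup H] [InnerProductSpace ℝ H]
    [MeasurableSpace Ω] (X : H → Ω → ℝ) (P : Measure Ω) (p : ℝ≥0∞)
    (F : Ω → ℝ) (DF : Ω → H) (D2F : Ω → HTensor H) : Prop where
  memLp : MemLp F p P
  memLp_D : MemLp DF p P
  memLp_D2 : MemLp D2F p P
  exists_seq : ∃ G : ℕ → Cylinder H,
    Tendsto (fun k ↦ eLpNorm (fun ω ↦ (G k).val X ω - F ω) p P) atTop (𝓝 0) ∧
    Tendsto (fun k ↦ eLpNorm (fun ω ↦ (G k).D X ω - DF ω) p P) atTop (𝓝 0) ∧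
    Tendsto (fun k ↦ eLpNorm (fun ω ↦ (G k).D2 X ω - D2F ω) p P) atTop (𝓝 0)

/-- The Wasserstein distance `sup_{‖f‖_Lip ≤ 1} |∫ f dμ - ∫ f dν|` between two laws on `ℝ` with
finite first moment. -/
def wassersteinDist (μ ν : Measure ℝ) : ℝ≥0∞ :=
  ⨆ (f : ℝ → ℝ) (_ : LipschitzWith 1 f), ENNReal.ofReal |∫ x, f x ∂μ - ∫ x, f x ∂ν|

/-- The total variation distance `sup_A |μ(A) - ν(A)|` (`A` Borel) between two probability laws
on `ℝ`. -/
def tvDist (μ ν : Measure ℝ) : ℝ≥0∞ :=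
  ⨆ (A : Set ℝ) (_ : MeasurableSet A), ENNReal.ofReal |μ.real A - ν.real A|

end Malliavin

end

/-!
The Gaussian vector behind a cylindrical random variable can be realised as a standard Gaussian
vector in the span of its directions, where integration by parts along the Mehler operators gives
`Cov(k(x), f(x)) = ∫₀^{π/2} sin θ E⟨∇k(x), E'[∇f(cos θ x + sin θ y)]⟩ dθ`. Taking `k = h ∘ f`, this
bounds the defect `Cov(h(F), F) - Var(F) E[h'(F)]` in Stein's identity by `‖h'‖_∞` times the `L¹`
norm of a centred quadratic expression in `∇f`, which the Poincaré inequality and Hölder's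
inequality bound by `3/2 E[‖D²F‖⁴]^{1/4} E[‖DF‖⁴]^{1/4}`. This survives `L⁴` limits, and Stein's
method turns it into a bound on both distances, with the constant `3` in place of `√10`.
-/

open scoped BoundedContinuousFunction

namespace Malliavin

/-! ### Gaussian integration by parts -/

lemma hasDerivAt_gaussianPDFReal (μ : ℝ) (v : ℝ≥0) (x : ℝ) :
    HasDerivAt (gaussianPDFReal μ v) (-((x - μ) / v * gaussianPDFReal μ v x)) x := by
  have hexp : HasDerivAt (fun x ↦ -(x - μ) ^ 2 / (2 * v)) (-((x - μ) / v)) x := by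
    refine ((((hasDerivAt_id x).sub_const μ).pow 2).neg.div_const (2 * (v : ℝ))).congr_deriv ?_
    simp only [id, Nat.cast_ofNat]
    ring
  rw [gaussianPDFReal_def]
  exact (hexp.exp.const_mul _).congr_deriv (by ring)

lemma integrable_gaussianReal_iff {μ : ℝ} {v : ℝ≥0} (hv : v ≠ 0) {g : ℝ → ℝ} :
    Integrable g (gaussianReal μ v) ↔ Integrable fun x ↦ g x * gaussianPDFReal μ v x := by
  rw [gaussianReal_of_var_ne_zero μ hv, integrable_withDensity_iff (measurable_gaussianPDF μ v)
    (ae_of_all _ fun _ ↦ gaussianPDF_lt_top)]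
  simp only [toReal_gaussianPDF]

lemma integral_sub_mul_gaussianReal {μ : ℝ} {v : ℝ≥0} {g g' : ℝ → ℝ}
    (hg : ∀ x, HasDerivAt g (g' x) x) (hgi : Integrable g (gaussianReal μ v))
    (hgi' : Integrable g' (gaussianReal μ v))
    (hxg : Integrable (fun x ↦ (x - μ) * g x) (gaussianReal μ v)) :
    ∫ x, (x - μ) * g x ∂gaussianReal μ v = v * ∫ x, g' x ∂gaussianReal μ v := by
  rcases eq_or_ne v 0 with rfl | hv
  · simp
  rw [integrable_gaussianReal_iff hv] at hgi hgi' hxg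
  have hv' : (v : ℝ) ≠ 0 := by exact_mod_cast hv
  have hparts := integral_mul_deriv_eq_deriv_mul_of_integrable (fun x _ ↦ hg x)
    (fun x _ ↦ hasDerivAt_gaussianPDFReal μ v x)
    ((hxg.div_const (-(v : ℝ))).congr (ae_of_all _ fun x ↦ by simp only [Pi.mul_apply]; field_simp))
    hgi' hgi
  calc ∫ x, (x - μ) * g x ∂gaussianReal μ v
      = -v * ∫ x, g x * -((x - μ) / v * gaussianPDFReal μ v x) := by
        rw [integral_gaussianReal_eq_integral_smul hv, ← integral_const_mul]
        refine integral_congr_ae (ae_of_all _ fun x ↦ ?_)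
        simp only [smul_eq_mul]
        field_simp
    _ = v * ∫ x, g' x ∂gaussianReal μ v := by
        rw [hparts, integral_gaussianReal_eq_integral_smul hv, neg_mul_neg]
        simp only [smul_eq_mul, mul_comm]

lemma integral_comp_of_measurePreserving {α β G : Type*} [MeasurableSpace α] [MeasurableSpace β]
    [NormedAddCommGroup G] [NormedSpace ℝ G] {μ : Measure α} {ν : Measure β} {m : α → β}
    (hm : MeasurePreserving m μ ν) {f : β → G} (hf : AEStronglyMeasurable f ν) :
    ∫ x, f (m x) ∂μ = ∫ y, f y ∂ν := by
  rw [← integral_map hm.aemeasurable (hm.map_eq.symm ▸ hf), hm.map_eq]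

section StandardGaussian

variable {E : Type*} [NormedAddCommGroup E] [InnerProductSpace ℝ E] [FiniteDimensional ℝ E]
  [MeasurableSpace E] [BorelSpace E]

local notation "γ" => stdGaussian E

lemma measurePreserving_sub_inner_smul_add_smul {v : E} (hv : ‖v‖ = 1) :
    MeasurePreserving (fun q : E × ℝ ↦ (q.1 - ⟪v, q.1⟫_ℝ • v) + q.2 • v)
      ((γ).prod (gaussianReal 0 1)) γ := by
  refine ⟨by fun_prop, Measure.ext_of_charFun ?_⟩
  ext t
  have hsplit (q : E × ℝ) : Complex.exp (⟪(q.1 - ⟪v, q.1⟫_ℝ • v) + q.2 • v, t⟫_ℝ * Complex.I)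
      = Complex.exp (⟪q.1, t - ⟪v, t⟫_ℝ • v⟫_ℝ * Complex.I) *
        Complex.exp (⟪q.2, ⟪v, t⟫_ℝ⟫_ℝ * Complex.I) := by
    rw [← Complex.exp_add, ← add_mul, ← Complex.ofReal_add]
    congr 3
    simp only [inner_add_left, inner_sub_left, inner_sub_right, real_inner_smul_left,
      real_inner_smul_right, RCLike.inner_apply, conj_trivial, real_inner_comm v q.1]
    ring
  have hpythagoras : ((‖t - ⟪v, t⟫_ℝ • v‖ : ℂ)) ^ 2 = (‖t‖ : ℂ) ^ 2 - (⟪v, t⟫_ℝ : ℂ) ^ 2 := by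
    norm_cast
    rw [norm_sub_sq_real, norm_smul, hv, real_inner_smul_right, real_inner_comm, mul_one,
      Real.norm_eq_abs, sq_abs]
    ring
  rw [charFun_apply, integral_map (by fun_prop) (by fun_prop)]
  simp_rw [hsplit]
  rw [integral_prod_mul (fun x : E ↦ Complex.exp (⟪x, t - ⟪v, t⟫_ℝ • v⟫_ℝ * Complex.I))
    (fun s : ℝ ↦ Complex.exp (⟪s, ⟪v, t⟫_ℝ⟫_ℝ * Complex.I)), ← charFun_apply, ← charFun_apply,
    charFun_stdGaussian, charFun_gaussianReal, charFun_stdGaussian, ← Complex.exp_add, hpythagoras]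
  push_cast
  ring_nf

lemma integral_inner_mul_stdGaussian_of_norm_eq_one {w : E →ᵇ ℝ} {gw : E →ᵇ E}
    (hw : ∀ x, HasGradientAt w (gw x) x) {v : E} (hv : ‖v‖ = 1) :
    ∫ x, ⟪v, x⟫_ℝ * w x ∂γ = ∫ x, ⟪v, gw x⟫_ℝ ∂γ := by
  set m : E × ℝ → E := fun q ↦ (q.1 - ⟪v, q.1⟫_ℝ • v) + q.2 • v with hm_def
  have hm : MeasurePreserving m ((γ).prod (gaussianReal 0 1)) γ :=
    measurePreserving_sub_inner_smul_add_smul hv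
  have hvm (q : E × ℝ) : ⟪v, m q⟫_ℝ = q.2 := by
    simp only [hm_def, inner_add_right, inner_sub_right, real_inner_smul_right,
      real_inner_self_eq_norm_sq, hv]
    ring
  have hmc (x : E) : Continuous fun t ↦ m (x, t) := by fun_prop
  have hI₁ : Integrable (fun x ↦ ⟪v, x⟫_ℝ * w x) γ :=
    (IsGaussian.integrable_dual γ (innerSL ℝ v)).mul_bdd w.continuous.aestronglyMeasurable
      (ae_of_all _ w.norm_coe_le_norm)
  have hI₂ : Integrable (fun x ↦ ⟪v, gw x⟫_ℝ) γ := (gw.integrable γ).const_inner v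
  have hline (x : E) : ∫ t, t * w (m (x, t)) ∂gaussianReal 0 1
      = ∫ t, ⟪v, gw (m (x, t))⟫_ℝ ∂gaussianReal 0 1 := by
    have hderiv (t : ℝ) : HasDerivAt (fun t ↦ w (m (x, t))) ⟪v, gw (m (x, t))⟫_ℝ t := by
      have hmt : HasDerivAt (fun t ↦ m (x, t)) v t := by
        simpa [hm_def] using ((hasDerivAt_id t).smul_const v).const_add (x - ⟪v, x⟫_ℝ • v)
      exact ((hw _).hasFDerivAt.comp_hasDerivAt t hmt).congr_deriv (by simp [real_inner_comm])
    let wm : ℝ →ᵇ ℝ := w.compContinuous ⟨_, hmc x⟩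
    have hid : Integrable (fun t ↦ t * w (m (x, t))) (gaussianReal 0 1) :=
      (IsGaussian.integrable_dual _ (.id ℝ ℝ)).mul_bdd wm.continuous.aestronglyMeasurable
        (ae_of_all _ wm.norm_coe_le_norm)
    simpa using integral_sub_mul_gaussianReal (μ := 0) (v := 1) hderiv (wm.integrable _)
      (((gw.compContinuous ⟨_, hmc x⟩).integrable _).const_inner v) (by simpa using hid)
  calc ∫ x, ⟪v, x⟫_ℝ * w x ∂γ
      = ∫ q, q.2 * w (m q) ∂((γ).prod (gaussianReal 0 1)) := by
        simp_rw [← integral_comp_of_measurePreserving hm hI₁.aestronglyMeasurable, hvm]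
    _ = ∫ x, ∫ t, t * w (m (x, t)) ∂gaussianReal 0 1 ∂γ :=
        integral_prod _ (by
          simpa [Function.comp_def, hvm] using hm.integrable_comp_of_integrable hI₁)
    _ = ∫ x, ∫ t, ⟪v, gw (m (x, t))⟫_ℝ ∂gaussianReal 0 1 ∂γ := by simp only [hline]
    _ = ∫ q, ⟪v, gw (m q)⟫_ℝ ∂((γ).prod (gaussianReal 0 1)) :=
        (integral_prod _ (hm.integrable_comp_of_integrable hI₂)).symm
    _ = ∫ x, ⟪v, gw x⟫_ℝ ∂γ := integral_comp_of_measurePreserving hm hI₂.aestronglyMeasurable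

lemma integral_inner_mul_stdGaussian {w : E →ᵇ ℝ} {gw : E →ᵇ E}
    (hw : ∀ x, HasGradientAt w (gw x) x) (v : E) :
    ∫ x, ⟪v, x⟫_ℝ * w x ∂γ = ∫ x, ⟪v, gw x⟫_ℝ ∂γ := by
  rcases eq_or_ne v 0 with rfl | hv
  · simp
  have hunit := integral_inner_mul_stdGaussian_of_norm_eq_one hw
    (v := ‖v‖⁻¹ • v) (norm_smul_inv_norm (𝕜 := ℝ) hv)
  simp only [real_inner_smul_left, mul_assoc, integral_const_mul] at hunit
  exact mul_left_cancel₀ (inv_ne_zero (norm_ne_zero_iff.2 hv)) hunit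

end StandardGaussian

/-! ### Mehler operators, the covariance formula and the Poincaré inequality -/

section PointwiseBilin

variable {α F₁ F₂ F₃ : Type*} [TopologicalSpace α] [NormedAddCommGroup F₁] [NormedSpace ℝ F₁]
  [NormedAddCommGroup F₂] [NormedSpace ℝ F₂] [NormedAddCommGroup F₃] [NormedSpace ℝ F₃]

/-- The pointwise product of two bounded continuous functions for a bounded bilinear map. -/
noncomputable def pointwiseBilin (B : F₁ →L[ℝ] F₂ →L[ℝ] F₃) (u : α →ᵇ F₁) (g : α →ᵇ F₂) :
    α →ᵇ F₃ :=
  .ofNormedAddCommGroup (fun x ↦ B (u x) (g x))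
    ((B.continuous.comp u.continuous).clm_apply g.continuous) (‖B‖ * ‖u‖ * ‖g‖) fun x ↦
      (B.le_opNorm₂ _ _).trans (by gcongr <;> exact BoundedContinuousFunction.norm_coe_le_norm _ _)

lemma pointwiseBilin_apply (B : F₁ →L[ℝ] F₂ →L[ℝ] F₃) (u : α →ᵇ F₁) (g : α →ᵇ F₂) (x : α) :
    pointwiseBilin B u g x = B (u x) (g x) := rfl

end PointwiseBilin

section Hoelder

variable {α F₁ F₂ F₃ : Type*} [MeasurableSpace α] {ν : Measure α} [NormedAddCommGroup F₁]
  [NormedAddCommGroup F₂] [NormedAddCommGroup F₃]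

lemma lpNorm_le_lpNorm_mul_lpNorm_of_norm_le {p q r : ℝ≥0∞} [ENNReal.HolderTriple p q r]
    {f : α → F₁} {g : α → F₂} {h : α → F₃} (hf : MemLp f p ν) (hg : MemLp g q ν)
    (hh : ∀ x, ‖h x‖ ≤ ‖f x‖ * ‖g x‖) : lpNorm h r ν ≤ lpNorm f p ν * lpNorm g q ν := by
  by_cases hhm : AEStronglyMeasurable h ν
  swap
  · rw [lpNorm_of_not_aestronglyMeasurable hhm]
    exact mul_nonneg lpNorm_nonneg lpNorm_nonneg
  rw [← toReal_eLpNorm hhm, ← toReal_eLpNorm hf.1, ← toReal_eLpNorm hg.1, ← ENNReal.toReal_mul]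
  refine ENNReal.toReal_mono (ENNReal.mul_ne_top hf.2.ne hg.2.ne) ?_
  calc eLpNorm h r ν ≤ eLpNorm (fun x ↦ ‖f x‖ * ‖g x‖) r ν := eLpNorm_mono_real hh
    _ ≤ eLpNorm f p ν * eLpNorm g q ν := by
      simpa using eLpNorm_le_eLpNorm_mul_eLpNorm'_of_norm hf.1 hg.1
        (fun a b ↦ ‖a‖ * ‖b‖) 1 (ae_of_all _ fun x ↦ by simp)

lemma abs_integral_inner_le_lpNorm_mul_lpNorm {F : Type*} [NormedAddCommGroup F]
    [InnerProductSpace ℝ F] {f g : α → F} (hf : MemLp f 2 ν) (hg : MemLp g 2 ν) :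
    |∫ x, ⟪f x, g x⟫_ℝ ∂ν| ≤ lpNorm f 2 ν * lpNorm g 2 ν := by
  calc |∫ x, ⟪f x, g x⟫_ℝ ∂ν| ≤ ∫ x, |⟪f x, g x⟫_ℝ| ∂ν := abs_integral_le_integral_abs
    _ = lpNorm (fun x ↦ ⟪f x, g x⟫_ℝ) 1 ν :=
      (lpNorm_one_eq_integral_norm (hf.1.inner (𝕜 := ℝ) hg.1)).symm
    _ ≤ lpNorm f 2 ν * lpNorm g 2 ν :=
      lpNorm_le_lpNorm_mul_lpNorm_of_norm_le hf hg fun x ↦ norm_inner_le_norm _ _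

lemma variance_eq_sq_lpNorm {X : α → ℝ} (hX : AEMeasurable X ν) :
    Var[X; ν] = lpNorm (fun x ↦ X x - ∫ y, X y ∂ν) 2 ν ^ 2 := by
  rw [variance_eq_integral hX, lpNorm_eq_integral_norm_rpow_toReal two_ne_zero ENNReal.ofNat_ne_top
    (hX.sub_const _).aestronglyMeasurable, ← Real.rpow_natCast, ← Real.rpow_mul (by positivity)]
  simp

lemma covariance_eq_integral_mul_sub [IsProbabilityMeasure ν] {X Y : α → ℝ} (hX : MemLp X 2 ν)
    (hY : MemLp Y 2 ν) : cov[X, Y; ν] = ∫ x, X x * (Y x - ∫ y, Y y ∂ν) ∂ν := by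
  have hYi : Integrable Y ν := hY.integrable one_le_two
  have hYc : MemLp (fun x ↦ Y x - ∫ y, Y y ∂ν) 2 ν := hY.sub (memLp_const _)
  rw [← covariance_sub_const_right hYi (∫ y, Y y ∂ν), covariance_eq_sub hX hYc,
    integral_sub hYi (integrable_const _)]
  simp

lemma abs_covariance_le_mul_sqrt_variance [IsProbabilityMeasure ν] {X Y : α → ℝ} {M : ℝ}
    (hXm : AEStronglyMeasurable X ν) (hX : ∀ x, |X x| ≤ M) (hY : MemLp Y 2 ν) :
    |cov[X, Y; ν]| ≤ M * √Var[Y; ν] := by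
  have hXc : MemLp X 2 ν := .of_bound hXm M (ae_of_all _ hX)
  have hYc : MemLp (fun x ↦ Y x - ∫ y, Y y ∂ν) 2 ν := hY.sub (memLp_const _)
  have hXM : lpNorm X 2 ν ≤ M := by
    obtain ⟨x⟩ := ν.nonempty_of_neZero
    refine (lpNorm_mono_real (memLp_const M) hX).trans_eq ?_
    rw [lpNorm_const two_ne_zero (NeZero.ne ν), probReal_univ, Real.one_rpow, mul_one,
      Real.norm_of_nonneg ((abs_nonneg _).trans (hX x))]
  calc |cov[X, Y; ν]| ≤ lpNorm X 2 ν * lpNorm (fun x ↦ Y x - ∫ y, Y y ∂ν) 2 ν :=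
        covariance_eq_integral_mul_sub hXc hY ▸ by
          simpa [mul_comm] using abs_integral_inner_le_lpNorm_mul_lpNorm hXc hYc
    _ ≤ M * √Var[Y; ν] := by
        rw [variance_eq_sq_lpNorm hY.1.aemeasurable, Real.sqrt_sq lpNorm_nonneg]
        exact mul_le_mul_of_nonneg_right hXM lpNorm_nonneg

lemma memLp_boundedContinuousFunction [TopologicalSpace α] [OpensMeasurableSpace α]
    [SecondCountableTopologyEither α F₁] [IsFiniteMeasure ν] (f : α →ᵇ F₁) (p : ℝ≥0∞) :
    MemLp f p ν :=
  .of_bound f.continuous.aestronglyMeasurable ‖f‖ (ae_of_all _ f.norm_coe_le_norm)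

end Hoelder

section Mehler

variable {E F F₁ F₂ : Type*} [NormedAddCommGroup E] [InnerProductSpace ℝ E] [FiniteDimensional ℝ E]
  [MeasurableSpace E] [BorelSpace E] [NormedAddCommGroup F]

local notation "γ" => stdGaussian E

lemma measurePreserving_rotation (θ : ℝ) :
    MeasurePreserving (ContinuousLinearMap.rotation θ : E × E →L[ℝ] E × E)
      ((γ).prod γ) ((γ).prod γ) :=
  ⟨by fun_prop, IsGaussian.map_rotation_eq_self (by simp) θ⟩

lemma measurePreserving_cos_smul_add_sin_smul (θ : ℝ) :
    MeasurePreserving (fun p : E × E ↦ Real.cos θ • p.1 + Real.sin θ • p.2) ((γ).prod γ) γ :=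
  measurePreserving_fst.comp (measurePreserving_rotation θ)

lemma integrable_comp_cos_smul_add_sin_smul (θ : ℝ) (g : E →ᵇ F) (x : E) :
    Integrable (fun y ↦ g (Real.cos θ • x + Real.sin θ • y)) γ :=
  .of_bound (g.continuous.comp (by fun_prop)).aestronglyMeasurable ‖g‖
    (ae_of_all _ fun _ ↦ g.norm_coe_le_norm _)

variable [NormedSpace ℝ F]

/-- The Mehler operator `g ↦ E[g(cos θ x + sin θ Y)]`, with `Y` a standard Gaussian vector. It is
the Ornstein-Uhlenbeck semigroup at the time `t` with `exp (-t) = cos θ`; the angle `θ` makes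
the covariance formula an integral over a bounded interval. -/
noncomputable def mehler (θ : ℝ) (g : E →ᵇ F) : E →ᵇ F :=
  .ofNormedAddCommGroup (fun x ↦ ∫ y, g (Real.cos θ • x + Real.sin θ • y) ∂γ)
    (continuous_of_dominated (bound := fun _ ↦ ‖g‖)
      (fun x ↦ (g.continuous.comp (by fun_prop)).aestronglyMeasurable)
      (fun x ↦ ae_of_all _ fun y ↦ g.norm_coe_le_norm _) (integrable_const _)
      (ae_of_all _ fun y ↦ g.continuous.comp (by fun_prop))) ‖g‖
    fun x ↦ (norm_integral_le_of_norm_le_const (ae_of_all _ fun y ↦ g.norm_coe_le_norm _)).trans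
      (by simp)

lemma hasFDerivAt_mehler {f : E →ᵇ F} {f' : E →ᵇ E →L[ℝ] F} (hf : ∀ x, HasFDerivAt f (f' x) x)
    (θ : ℝ) (x : E) : HasFDerivAt (mehler θ f) (Real.cos θ • mehler θ f' x) x := by
  have hderiv (x y : E) : HasFDerivAt (fun x ↦ f (Real.cos θ • x + Real.sin θ • y))
      (Real.cos θ • f' (Real.cos θ • x + Real.sin θ • y)) x := by
    have hline : HasFDerivAt (fun x : E ↦ Real.cos θ • x + Real.sin θ • y)
        (Real.cos θ • ContinuousLinearMap.id ℝ E) x :=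
      ((hasFDerivAt_id x).const_smul _).add_const _
    exact ((hf _).comp x hline).congr_fderiv (by ext; simp)
  have hint := hasFDerivAt_integral_of_dominated_of_fderiv_le (x₀ := x) univ_mem
    (Eventually.of_forall fun x ↦ (integrable_comp_cos_smul_add_sin_smul θ f x).1)
    (integrable_comp_cos_smul_add_sin_smul θ f x)
    ((integrable_comp_cos_smul_add_sin_smul θ f' x).smul (Real.cos θ)).1
    (ae_of_all _ fun y z _ ↦ (norm_smul_le _ _).trans (mul_le_mul (Real.abs_cos_le_one θ)
      (f'.norm_coe_le_norm _) (norm_nonneg _) zero_le_one))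
    (integrable_const _) (ae_of_all γ fun y z _ ↦ hderiv z y)
  rwa [integral_smul] at hint

lemma eLpNorm_mehler_le {p : ℝ≥0∞} (hp : 1 ≤ p) (hp' : p ≠ ∞) (θ : ℝ) (g : E →ᵇ F) :
    eLpNorm (mehler θ g) p γ ≤ eLpNorm g p γ := by
  have hp0 : p ≠ 0 := (zero_lt_one.trans_le hp).ne'
  have hpos : 0 < p.toReal := ENNReal.toReal_pos hp0 hp'
  have hjensen (x : E) : ‖mehler θ g x‖ₑ ^ p.toReal
      ≤ ∫⁻ y, ‖g (Real.cos θ • x + Real.sin θ • y)‖ₑ ^ p.toReal ∂γ := by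
    rw [← ENNReal.le_rpow_inv_iff hpos, ← one_div]
    calc ‖mehler θ g x‖ₑ ≤ eLpNorm (fun y ↦ g (Real.cos θ • x + Real.sin θ • y)) 1 γ :=
          (enorm_integral_le_lintegral_enorm _).trans_eq eLpNorm_one_eq_lintegral_enorm.symm
      _ ≤ eLpNorm (fun y ↦ g (Real.cos θ • x + Real.sin θ • y)) p γ :=
          eLpNorm_le_eLpNorm_of_exponent_le hp (integrable_comp_cos_smul_add_sin_smul θ g x).1
      _ = _ := eLpNorm_eq_lintegral_rpow_enorm_toReal hp0 hp'
  have hmeas : Measurable fun x ↦ ‖g x‖ₑ ^ p.toReal :=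
    (g.continuous.enorm.measurable).pow_const _
  rw [eLpNorm_eq_lintegral_rpow_enorm_toReal hp0 hp',
    eLpNorm_eq_lintegral_rpow_enorm_toReal hp0 hp']
  gcongr ?_ ^ _
  calc ∫⁻ x, ‖mehler θ g x‖ₑ ^ p.toReal ∂γ
      ≤ ∫⁻ x, ∫⁻ y, ‖g (Real.cos θ • x + Real.sin θ • y)‖ₑ ^ p.toReal ∂γ ∂γ :=
        lintegral_mono hjensen
    _ = ∫⁻ p', ‖g (Real.cos θ • p'.1 + Real.sin θ • p'.2)‖ₑ ^ p.toReal ∂(γ).prod γ :=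
        lintegral_lintegral (hmeas.comp (by fun_prop)).aemeasurable
    _ = ∫⁻ x, ‖g x‖ₑ ^ p.toReal ∂γ :=
        (measurePreserving_cos_smul_add_sin_smul θ).lintegral_comp hmeas

lemma lpNorm_mehler_le {p : ℝ≥0∞} (hp : 1 ≤ p) (hp' : p ≠ ∞) (θ : ℝ) (g : E →ᵇ F) :
    lpNorm (mehler θ g) p γ ≤ lpNorm g p γ := by
  rw [← toReal_eLpNorm (mehler θ g).continuous.aestronglyMeasurable,
    ← toReal_eLpNorm g.continuous.aestronglyMeasurable]
  exact ENNReal.toReal_mono (memLp_boundedContinuousFunction g p).2.ne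
    (eLpNorm_mehler_le hp hp' θ g)

variable [CompleteSpace F] [NormedAddCommGroup F₁] [NormedSpace ℝ F₁] [NormedAddCommGroup F₂]
  [NormedSpace ℝ F₂] [CompleteSpace F₂]

lemma integral_pointwiseBilin_mehler (B : F₁ →L[ℝ] F →L[ℝ] F₂) (u : E →ᵇ F₁) (g : E →ᵇ F) (θ : ℝ) :
    ∫ x, B (u x) (mehler θ g x) ∂γ
      = ∫ p, B (u p.1) (g (Real.cos θ • p.1 + Real.sin θ • p.2)) ∂(γ).prod γ := by
  have hint : Integrable (fun p : E × E ↦ B (u p.1) (g (Real.cos θ • p.1 + Real.sin θ • p.2)))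
      ((γ).prod γ) :=
    memLp_one_iff_integrable.1 <| memLp_boundedContinuousFunction (pointwiseBilin B
      (u.compContinuous ⟨Prod.fst, continuous_fst⟩) (g.compContinuous
        ⟨fun p : E × E ↦ Real.cos θ • p.1 + Real.sin θ • p.2, by fun_prop⟩)) 1
  rw [integral_prod _ hint]
  exact integral_congr_ae (ae_of_all _ fun x ↦
    ((B (u x)).integral_comp_comm (integrable_comp_cos_smul_add_sin_smul θ g x)).symm)

end Mehler

section Covariance

variable {E : Type*} [NormedAddCommGroup E] [InnerProductSpace ℝ E]

lemma norm_mul_inner_le (a : ℝ) (b v : E) : ‖a * ⟪b, v⟫_ℝ‖ ≤ ‖a‖ * ‖b‖ * ‖v‖ := by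
  rw [norm_mul, mul_assoc]
  gcongr
  exact norm_inner_le_norm _ _

lemma norm_neg_sin_smul_add_cos_smul_le (θ : ℝ) (x y : E) :
    ‖-Real.sin θ • x + Real.cos θ • y‖ ≤ ‖x‖ + ‖y‖ := by
  refine (norm_add_le _ _).trans ?_
  rw [norm_smul, norm_smul, norm_neg]
  gcongr
  · exact mul_le_of_le_one_left (norm_nonneg _) (Real.abs_sin_le_one θ)
  · exact mul_le_of_le_one_left (norm_nonneg _) (Real.abs_cos_le_one θ)

lemma cos_smul_rotation_fst_sub_sin_smul_rotation_snd (θ : ℝ) (p : E × E) :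
    Real.cos θ • (Real.cos θ • p.1 + Real.sin θ • p.2)
      - Real.sin θ • (-Real.sin θ • p.1 + Real.cos θ • p.2) = p.1 := by
  calc _ = (Real.cos θ ^ 2 + Real.sin θ ^ 2) • p.1 := by module
    _ = p.1 := by rw [Real.cos_sq_add_sin_sq, one_smul]

lemma abs_integral_sin_mul_le {w c : ℝ → ℝ} (hc : Continuous c)
    (h : ∀ θ ∈ Set.Ioc 0 (Real.pi / 2), |w θ| ≤ c θ) :
    |∫ θ in (0 : ℝ)..(Real.pi / 2), Real.sin θ * w θ|
      ≤ ∫ θ in (0 : ℝ)..(Real.pi / 2), Real.sin θ * c θ := by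
  have hbound (θ : ℝ) (hθ : θ ∈ Set.Ioc 0 (Real.pi / 2)) :
      ‖Real.sin θ * w θ‖ ≤ Real.sin θ * c θ := by
    have hsin : 0 ≤ Real.sin θ :=
      Real.sin_nonneg_of_nonneg_of_le_pi hθ.1.le (by linarith [hθ.2, Real.pi_pos])
    rw [norm_mul, Real.norm_of_nonneg hsin]
    exact mul_le_mul_of_nonneg_left (h θ hθ) hsin
  exact intervalIntegral.norm_integral_le_of_norm_le Real.pi_div_two_pos.le
    (ae_of_all volume hbound) ((Real.continuous_sin.mul hc).intervalIntegrable _ _)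

variable [FiniteDimensional ℝ E] [MeasurableSpace E] [BorelSpace E] {u f : E →ᵇ ℝ}
  {gu gf : E →ᵇ E}

local notation "γ" => stdGaussian E

lemma integrable_norm_fst_add_norm_snd :
    Integrable (fun p : E × E ↦ ‖p.1‖ + ‖p.2‖) ((γ).prod γ) :=
  have hnorm : Integrable (fun x : E ↦ ‖x‖) γ := IsGaussian.integrable_id.norm
  (hnorm.comp_fst γ).add (hnorm.comp_snd γ)

lemma hasDerivAt_integral_mul_rotation (hf : ∀ x, HasGradientAt f (gf x) x) (θ : ℝ) :
    HasDerivAt (fun θ ↦ ∫ p : E × E, u p.1 * f (Real.cos θ • p.1 + Real.sin θ • p.2) ∂(γ).prod γ)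
      (∫ p : E × E, u p.1 * ⟪gf (Real.cos θ • p.1 + Real.sin θ • p.2),
        -Real.sin θ • p.1 + Real.cos θ • p.2⟫_ℝ ∂(γ).prod γ) θ := by
  have hrot (θ : ℝ) : Continuous fun p : E × E ↦ Real.cos θ • p.1 + Real.sin θ • p.2 := by fun_prop
  have hint (θ : ℝ) : Integrable
      (fun p : E × E ↦ u p.1 * f (Real.cos θ • p.1 + Real.sin θ • p.2)) ((γ).prod γ) :=
    memLp_one_iff_integrable.1 <| memLp_boundedContinuousFunction
      (u.compContinuous ⟨Prod.fst, continuous_fst⟩ * f.compContinuous ⟨_, hrot θ⟩) 1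
  refine (hasDerivAt_integral_of_dominated_loc_of_deriv_le (μ := (γ).prod γ) (x₀ := θ)
    (F' := fun θ p ↦ u p.1 * ⟪gf (Real.cos θ • p.1 + Real.sin θ • p.2),
      -Real.sin θ • p.1 + Real.cos θ • p.2⟫_ℝ)
    (bound := fun p ↦ ‖u‖ * ‖gf‖ * (‖p.1‖ + ‖p.2‖)) univ_mem
    (Eventually.of_forall fun θ ↦ (hint θ).1) (hint θ) (Continuous.aestronglyMeasurable ?_)
    (ae_of_all _ fun p θ _ ↦ (norm_mul_inner_le _ _ _).trans ?_)
    (integrable_norm_fst_add_norm_snd.const_mul _)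
    (ae_of_all _ fun p θ _ ↦ ?_)).2
  · have := u.continuous
    have := gf.continuous
    fun_prop
  · gcongr
    · exact u.norm_coe_le_norm _
    · exact gf.norm_coe_le_norm _
    · exact norm_neg_sin_smul_add_cos_smul_le θ _ _
  · have hcircle : HasDerivAt (fun θ ↦ Real.cos θ • p.1 + Real.sin θ • p.2)
        (-Real.sin θ • p.1 + Real.cos θ • p.2) θ :=
      ((Real.hasDerivAt_cos θ).smul_const _).add ((Real.hasDerivAt_sin θ).smul_const _)
    exact (((hf _).hasFDerivAt.comp_hasDerivAt θ hcircle).const_mul (u p.1)).congr_deriv (by simp)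

lemma integral_mul_inner_cos_smul_sub_sin_smul (hu : ∀ x, HasGradientAt u (gu x) x)
    (θ : ℝ) (a v : E) :
    ∫ b, u (Real.cos θ • a - Real.sin θ • b) * ⟪v, b⟫_ℝ ∂γ
      = -(Real.sin θ * ∫ b, ⟪gu (Real.cos θ • a - Real.sin θ • b), v⟫_ℝ ∂γ) := by
  let line : C(E, E) := ⟨fun b ↦ Real.cos θ • a - Real.sin θ • b, by fun_prop⟩
  have hgrad (b : E) : HasGradientAt (u.compContinuous line)
      ((-Real.sin θ • gu.compContinuous line) b) b := by
    have hline : HasFDerivAt line (-(Real.sin θ • ContinuousLinearMap.id ℝ E)) b :=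
      ((hasFDerivAt_id b).const_smul (Real.sin θ)).const_sub _
    exact ((hu _).hasFDerivAt.comp b hline).congr_fderiv (by ext v; simp)
  calc ∫ b, u (line b) * ⟪v, b⟫_ℝ ∂γ
      = ∫ b, ⟪v, (-Real.sin θ • gu.compContinuous line) b⟫_ℝ ∂γ := by
        rw [← integral_inner_mul_stdGaussian hgrad v]
        simp only [mul_comm, BoundedContinuousFunction.compContinuous_apply]
    _ = -(Real.sin θ * ∫ b, ⟪gu (line b), v⟫_ℝ ∂γ) := by
        rw [← integral_const_mul, ← integral_neg]
        simp [inner_smul_right, real_inner_comm]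

lemma integral_mul_inner_rotation (hu : ∀ x, HasGradientAt u (gu x) x) (θ : ℝ) :
    ∫ p : E × E, u p.1 * ⟪gf (Real.cos θ • p.1 + Real.sin θ • p.2),
        -Real.sin θ • p.1 + Real.cos θ • p.2⟫_ℝ ∂(γ).prod γ
      = -(Real.sin θ * ∫ p : E × E, ⟪gu p.1, gf (Real.cos θ • p.1 + Real.sin θ • p.2)⟫_ℝ
          ∂(γ).prod γ) := by
  have hu_cont := u.continuous
  have hgu_cont := gu.continuous
  have hgf_cont := gf.continuous
  have hlhs : Continuous fun q : E × E ↦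
      u (Real.cos θ • q.1 - Real.sin θ • q.2) * ⟪gf q.1, q.2⟫_ℝ := by fun_prop
  have hrhs : Continuous fun q : E × E ↦
      ⟪gu (Real.cos θ • q.1 - Real.sin θ • q.2), gf q.1⟫_ℝ := by fun_prop
  have hlhs_int : Integrable (fun q : E × E ↦
      u (Real.cos θ • q.1 - Real.sin θ • q.2) * ⟪gf q.1, q.2⟫_ℝ) ((γ).prod γ) := by
    refine (integrable_norm_fst_add_norm_snd.const_mul (‖u‖ * ‖gf‖)).mono'
      hlhs.aestronglyMeasurable (ae_of_all _ fun q ↦ (norm_mul_inner_le _ _ _).trans ?_)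
    gcongr
    · exact u.norm_coe_le_norm _
    · exact gf.norm_coe_le_norm _
    · exact le_add_of_nonneg_left (norm_nonneg _)
  have hrhs_int : Integrable (fun q : E × E ↦
      ⟪gu (Real.cos θ • q.1 - Real.sin θ • q.2), gf q.1⟫_ℝ) ((γ).prod γ) :=
    .of_bound hrhs.aestronglyMeasurable (‖gu‖ * ‖gf‖) <| ae_of_all _ fun q ↦
      (norm_inner_le_norm _ _).trans
        (by gcongr <;> apply BoundedContinuousFunction.norm_coe_le_norm)
  have hlhs_rot := integral_comp_of_measurePreserving (measurePreserving_rotation (E := E) θ)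
    hlhs.aestronglyMeasurable
  have hrhs_rot := integral_comp_of_measurePreserving (measurePreserving_rotation (E := E) θ)
    hrhs.aestronglyMeasurable
  simp only [ContinuousLinearMap.rotation_apply, cos_smul_rotation_fst_sub_sin_smul_rotation_snd]
    at hlhs_rot hrhs_rot
  rw [hlhs_rot, hrhs_rot, integral_prod _ hlhs_int, integral_prod _ hrhs_int,
    ← integral_const_mul, ← integral_neg]
  exact integral_congr_ae (ae_of_all _ fun a ↦
    integral_mul_inner_cos_smul_sub_sin_smul hu θ a (gf a))

theorem covariance_stdGaussian_eq_integral_mehler (hu : ∀ x, HasGradientAt u (gu x) x)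
    (hf : ∀ x, HasGradientAt f (gf x) x) :
    cov[u, f; γ] = ∫ θ in (0 : ℝ)..(Real.pi / 2),
      Real.sin θ * ∫ x, ⟪gu x, mehler θ gf x⟫_ℝ ∂γ := by
  have hmehler (θ : ℝ) : ∫ x, ⟪gu x, mehler θ gf x⟫_ℝ ∂γ = ∫ p : E × E,
      ⟪gu p.1, gf (Real.cos θ • p.1 + Real.sin θ • p.2)⟫_ℝ ∂(γ).prod γ :=
    integral_pointwiseBilin_mehler (innerSL ℝ) gu gf θ
  have hcont : Continuous fun θ : ℝ ↦ ∫ x, ⟪gu x, mehler θ gf x⟫_ℝ ∂γ := by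
    have hgu_cont := gu.continuous
    have hgf_cont := gf.continuous
    simp only [hmehler]
    exact continuous_of_dominated (bound := fun _ ↦ ‖gu‖ * ‖gf‖)
      (fun θ ↦ Continuous.aestronglyMeasurable (by fun_prop))
      (fun θ ↦ ae_of_all _ fun p ↦ (norm_inner_le_norm _ _).trans
        (by gcongr <;> apply BoundedContinuousFunction.norm_coe_le_norm))
      (integrable_const _) (ae_of_all _ fun p ↦ by fun_prop)
  have hderiv (θ : ℝ) : HasDerivAt
      (fun θ ↦ ∫ p : E × E, u p.1 * f (Real.cos θ • p.1 + Real.sin θ • p.2) ∂(γ).prod γ)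
      (-(Real.sin θ * ∫ x, ⟪gu x, mehler θ gf x⟫_ℝ ∂γ)) θ := by
    rw [hmehler, ← integral_mul_inner_rotation hu θ]
    exact hasDerivAt_integral_mul_rotation hf θ
  have hftc := intervalIntegral.integral_eq_sub_of_hasDerivAt (a := 0) (b := Real.pi / 2)
    (fun θ _ ↦ hderiv θ) ((Real.continuous_sin.mul hcont).neg.intervalIntegrable _ _)
  rw [intervalIntegral.integral_neg] at hftc
  simp only [Real.cos_pi_div_two, Real.sin_pi_div_two, Real.cos_zero, Real.sin_zero, zero_smul,
    one_smul, zero_add, add_zero, integral_prod_mul (u : E → ℝ) (f : E → ℝ)] at hftc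
  rw [integral_fun_fst (fun x : E ↦ u x * f x), probReal_univ, one_smul] at hftc
  rw [covariance_eq_sub (memLp_boundedContinuousFunction u 2)
    (memLp_boundedContinuousFunction f 2)]
  simp only [Pi.mul_apply]
  linarith

theorem variance_stdGaussian_le_sq_lpNorm_gradient (hf : ∀ x, HasGradientAt f (gf x) x) :
    Var[f; γ] ≤ lpNorm gf 2 γ ^ 2 := by
  have hbound (θ : ℝ) : |∫ x, ⟪gf x, mehler θ gf x⟫_ℝ ∂γ| ≤ lpNorm gf 2 γ ^ 2 := by
    rw [sq]
    exact (abs_integral_inner_le_lpNorm_mul_lpNorm (memLp_boundedContinuousFunction gf 2)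
      (memLp_boundedContinuousFunction (mehler θ gf) 2)).trans (mul_le_mul_of_nonneg_left
        (lpNorm_mehler_le one_le_two ENNReal.ofNat_ne_top θ gf) lpNorm_nonneg)
  calc Var[f; γ] = cov[f, f; γ] := (covariance_self f.continuous.measurable.aemeasurable).symm
    _ ≤ |∫ θ in (0 : ℝ)..(Real.pi / 2), Real.sin θ * ∫ x, ⟪gf x, mehler θ gf x⟫_ℝ ∂γ| := by
      rw [covariance_stdGaussian_eq_integral_mehler hf hf]
      exact le_abs_self _
    _ ≤ ∫ θ in (0 : ℝ)..(Real.pi / 2), Real.sin θ * lpNorm gf 2 γ ^ 2 :=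
      abs_integral_sin_mul_le continuous_const fun θ _ ↦ hbound θ
    _ = lpNorm gf 2 γ ^ 2 := by simp

end Covariance

/-! ### The Stein discrepancy of a function of a standard Gaussian vector -/

/-- `F` satisfies Stein's identity `cov(h(F), F) = Var(F) E[h'(F)]`, which characterizes the normal
law, up to an error `κ` times the Lipschitz constant of `h`. -/
def HasSteinDiscrepancyLE {Ω : Type*} [MeasurableSpace Ω] (F : Ω → ℝ) (P : Measure Ω) (κ : ℝ) :
    Prop :=
  ∀ (M : ℝ≥0) (h : ℝ → ℝ), ContDiff ℝ 1 h → LipschitzWith M h →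
    |cov[h ∘ F, F; P] - Var[F; P] * ∫ ω, deriv h (F ω) ∂P| ≤ M * κ

section SteinDiscrepancy

variable {E : Type*} [NormedAddCommGroup E] [InnerProductSpace ℝ E] [FiniteDimensional ℝ E]
  [MeasurableSpace E] [BorelSpace E] {f : E →ᵇ ℝ} {g : E →ᵇ E} {A : E →ᵇ E →L[ℝ] E}

local notation "γ" => stdGaussian E

/-- The gradient of `x ↦ ⟪g x, P g x⟫`, where `P` is the Mehler operator of angle `θ` and `A` is the
derivative of `g`. -/
noncomputable def gradientInnerMehler (θ : ℝ) (g : E →ᵇ E) (A : E →ᵇ E →L[ℝ] E) : E →ᵇ E :=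
  pointwiseBilin (.id ℝ (E →L[ℝ] E)) (A.comp _ ContinuousLinearMap.adjoint.lipschitz) (mehler θ g)
    + Real.cos θ • pointwiseBilin (.id ℝ (E →L[ℝ] E))
      ((mehler θ A).comp _ ContinuousLinearMap.adjoint.lipschitz) g

lemma gradientInnerMehler_apply (θ : ℝ) (x : E) : gradientInnerMehler θ g A x =
    ContinuousLinearMap.adjoint (A x) (mehler θ g x)
      + Real.cos θ • ContinuousLinearMap.adjoint (mehler θ A x) (g x) := rfl

lemma hasGradientAt_inner_mehler (hg : ∀ x, HasFDerivAt g (A x) x) (θ : ℝ) (x : E) :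
    HasGradientAt (pointwiseBilin (innerSL ℝ) g (mehler θ g)) (gradientInnerMehler θ g A x) x := by
  refine ((hg x).inner ℝ (hasFDerivAt_mehler hg θ x)).congr_fderiv ?_
  ext v
  simp [gradientInnerMehler_apply, inner_smul_right,
    ContinuousLinearMap.adjoint_inner_left, real_inner_comm, add_comm]

instance holderTriple_four_four_two : ENNReal.HolderTriple 4 4 2 where
  inv_add_inv_eq_inv := by
    rw [← two_mul, show (4 : ℝ≥0∞) = 2 * 2 by norm_num,
      ENNReal.mul_inv (.inl two_ne_zero) (.inl ENNReal.ofNat_ne_top), ← mul_assoc,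
      ENNReal.mul_inv_cancel two_ne_zero ENNReal.ofNat_ne_top, one_mul]

lemma lpNorm_adjoint_apply_le (B : E →ᵇ E →L[ℝ] E) (w : E →ᵇ E) :
    lpNorm (fun x ↦ ContinuousLinearMap.adjoint (B x) (w x)) 2 γ
      ≤ lpNorm B 4 γ * lpNorm w 4 γ :=
  lpNorm_le_lpNorm_mul_lpNorm_of_norm_le (memLp_boundedContinuousFunction B 4)
    (memLp_boundedContinuousFunction w 4) fun x ↦
      (ContinuousLinearMap.le_opNorm _ _).trans_eq (by rw [LinearIsometryEquiv.norm_map])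

lemma lpNorm_gradientInnerMehler_le {θ : ℝ} (hθ : 0 ≤ Real.cos θ) :
    lpNorm (gradientInnerMehler θ g A) 2 γ
      ≤ (1 + Real.cos θ) * (lpNorm A 4 γ * lpNorm g 4 γ) := by
  have hA : lpNorm (mehler θ A) 4 γ ≤ lpNorm A 4 γ :=
    lpNorm_mehler_le (by norm_num) ENNReal.ofNat_ne_top θ A
  have hg : lpNorm (mehler θ g) 4 γ ≤ lpNorm g 4 γ :=
    lpNorm_mehler_le (by norm_num) ENNReal.ofNat_ne_top θ g
  have hfst := (lpNorm_adjoint_apply_le A (mehler θ g)).trans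
    (mul_le_mul_of_nonneg_left hg lpNorm_nonneg)
  have hsnd := (lpNorm_adjoint_apply_le (mehler θ A) g).trans
    (mul_le_mul_of_nonneg_right hA lpNorm_nonneg)
  calc _ ≤ lpNorm (fun x ↦ ContinuousLinearMap.adjoint (A x) (mehler θ g x)) 2 γ
        + lpNorm (Real.cos θ • fun x ↦ ContinuousLinearMap.adjoint (mehler θ A x) (g x)) 2 γ :=
        lpNorm_add_le (memLp_boundedContinuousFunction (pointwiseBilin (.id ℝ (E →L[ℝ] E))
          (A.comp _ ContinuousLinearMap.adjoint.lipschitz) (mehler θ g)) 2) one_le_two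
    _ ≤ lpNorm A 4 γ * lpNorm g 4 γ + Real.cos θ * (lpNorm A 4 γ * lpNorm g 4 γ) := by
        rw [lpNorm_const_smul, coe_nnnorm, Real.norm_of_nonneg hθ]
        gcongr
    _ = _ := by ring

lemma sqrt_variance_inner_mehler_le (hg : ∀ x, HasFDerivAt g (A x) x) {θ : ℝ}
    (hθ : 0 ≤ Real.cos θ) :
    √Var[pointwiseBilin (innerSL ℝ) g (mehler θ g); γ]
      ≤ (1 + Real.cos θ) * (lpNorm A 4 γ * lpNorm g 4 γ) := by
  refine (Real.sqrt_le_left lpNorm_nonneg).2 ?_ |>.trans (lpNorm_gradientInnerMehler_le hθ)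
  exact variance_stdGaussian_le_sq_lpNorm_gradient (hasGradientAt_inner_mehler hg θ)

lemma integral_sin_mul_one_add_cos :
    ∫ θ in (0 : ℝ)..(Real.pi / 2), Real.sin θ * (1 + Real.cos θ) = 3 / 2 := by
  have hcont : Continuous fun θ ↦ Real.sin θ * Real.cos θ := by fun_prop
  simp_rw [mul_add, mul_one]
  rw [intervalIntegral.integral_add (Real.continuous_sin.intervalIntegrable _ _)
    (hcont.intervalIntegrable _ _), integral_sin, integral_sin_mul_cos₁]
  norm_num

lemma integral_inner_sub_integral_smul_eq_covariance (v : E →ᵇ ℝ) (g w : E →ᵇ E) :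
    ∫ x, ⟪(v x - ∫ y, v y ∂γ) • g x, w x⟫_ℝ ∂γ = cov[v, pointwiseBilin (innerSL ℝ) g w; γ] := by
  rw [covariance_comm, covariance_eq_integral_mul_sub (memLp_boundedContinuousFunction _ 2)
    (memLp_boundedContinuousFunction v 2)]
  exact integral_congr_ae (ae_of_all _ fun x ↦ (real_inner_smul_left _ _ _).trans (mul_comm _ _))

theorem hasSteinDiscrepancyLE_stdGaussian (hf : ∀ x, HasGradientAt f (g x) x)
    (hg : ∀ x, HasFDerivAt g (A x) x) :
    HasSteinDiscrepancyLE f γ (3 / 2 * (lpNorm A 4 γ * lpNorm g 4 γ)) := by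
  intro M h hh hhM
  let hf' : E →ᵇ ℝ := .ofNormedAddCommGroup (fun x ↦ deriv h (f x))
    ((hh.continuous_deriv le_rfl).comp f.continuous) M fun x ↦ norm_deriv_le_of_lipschitz hhM
  set c := ∫ x, deriv h (f x) ∂γ
  let u : E →ᵇ ℝ := f.comp h hhM - c • f
  let gu : E →ᵇ E := pointwiseBilin (.lsmul ℝ ℝ) (hf' - .const E c) g
  have hu (x : E) : HasGradientAt u (gu x) x := by
    have hhf := (hh.differentiable one_ne_zero (f x)).hasDerivAt.comp_hasFDerivAt x
      (hf x).hasFDerivAt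
    refine (hhf.sub ((hf x).hasFDerivAt.const_smul c)).congr_fderiv ?_
    ext v
    simp [gu, hf', pointwiseBilin_apply]
  have hcov : cov[h ∘ f, f; γ] - Var[f; γ] * c = cov[u, f; γ] := by
    have hcov_sub : cov[u, f; γ] = cov[h ∘ f, f; γ] - cov[c • (f : E → ℝ), f; γ] :=
      covariance_sub_left (memLp_boundedContinuousFunction (f.comp h hhM) 2)
        (memLp_boundedContinuousFunction (c • f) 2) (memLp_boundedContinuousFunction f 2)
    rw [hcov_sub, covariance_smul_left, covariance_self f.continuous.measurable.aemeasurable,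
      mul_comm c]
  have hmehler (θ : ℝ) : ∫ x, ⟪gu x, mehler θ g x⟫_ℝ ∂γ
      = cov[hf', pointwiseBilin (innerSL ℝ) g (mehler θ g); γ] :=
    integral_inner_sub_integral_smul_eq_covariance hf' g (mehler θ g)
  have hbound (θ : ℝ) (hθ : θ ∈ Set.Ioc 0 (Real.pi / 2)) : |∫ x, ⟪gu x, mehler θ g x⟫_ℝ ∂γ|
      ≤ (1 + Real.cos θ) * (M * (lpNorm A 4 γ * lpNorm g 4 γ)) := by
    have hcos : 0 ≤ Real.cos θ :=
      Real.cos_nonneg_of_neg_pi_div_two_le_of_le (by linarith [hθ.1, Real.pi_pos]) hθ.2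
    calc _ ≤ M * √Var[pointwiseBilin (innerSL ℝ) g (mehler θ g); γ] :=
          hmehler θ ▸ abs_covariance_le_mul_sqrt_variance hf'.continuous.aestronglyMeasurable
            (fun x ↦ norm_deriv_le_of_lipschitz hhM) (memLp_boundedContinuousFunction _ 2)
      _ ≤ M * ((1 + Real.cos θ) * (lpNorm A 4 γ * lpNorm g 4 γ)) :=
          mul_le_mul_of_nonneg_left (sqrt_variance_inner_mehler_le hg hcos) M.2
      _ = _ := by ring
  rw [hcov, covariance_stdGaussian_eq_integral_mehler hu hf]
  refine (abs_integral_sin_mul_le (by fun_prop) hbound).trans_eq ?_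
  simp_rw [← mul_assoc, intervalIntegral.integral_mul_const]
  rw [integral_sin_mul_one_add_cos]
  ring

end SteinDiscrepancy

/-! ### Stein's method -/

/-- `f` solves the Stein equation `f' - x f = h - E h(Z)`, `Z ∼ 𝒩(0, 1)`. -/
def IsSteinSolution (f h : ℝ → ℝ) : Prop :=
  ∀ x, HasDerivAt f (x * f x + (h x - ∫ z, h z ∂gaussianReal 0 1)) x

section BoundedTestFunction

lemma hasDerivAt_setIntegral_Iic_gaussianReal {μ : ℝ} {v : ℝ≥0} (hv : v ≠ 0) {ψ : ℝ → ℝ}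
    (hψ : Continuous ψ) (hψi : Integrable ψ (gaussianReal μ v)) (x : ℝ) :
    HasDerivAt (fun x ↦ ∫ u in Set.Iic x, ψ u ∂gaussianReal μ v)
      (ψ x * gaussianPDFReal μ v x) x := by
  rw [integrable_gaussianReal_iff hv] at hψi
  have hIic (x : ℝ) : ∫ u in Set.Iic x, ψ u ∂gaussianReal μ v
      = ∫ u in Set.Iic x, ψ u * gaussianPDFReal μ v u := by
    rw [gaussianReal_of_var_ne_zero μ hv,
      setIntegral_withDensity_eq_setIntegral_toReal_smul (measurable_gaussianPDF μ v)
        (ae_of_all _ fun _ ↦ gaussianPDF_lt_top) _ measurableSet_Iic]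
    simp only [toReal_gaussianPDF, smul_eq_mul, mul_comm]
  have hpdf : Continuous (gaussianPDFReal μ v) :=
    continuous_iff_continuousAt.2 fun u ↦ (hasDerivAt_gaussianPDFReal μ v u).continuousAt
  have hFTC := intervalIntegral.integral_hasDerivAt_right (hψi.intervalIntegrable (a := 0) (b := x))
    ((hψ.mul hpdf).stronglyMeasurableAtFilter _ _) (hψ.mul hpdf).continuousAt
  refine (hFTC.const_add (∫ u in Set.Iic 0, ψ u * gaussianPDFReal μ v u)).congr_of_eventuallyEq
    (Eventually.of_forall fun y ↦ ?_)
  beta_reduce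
  rw [hIic, ← intervalIntegral.integral_Iic_sub_Iic hψi.integrableOn hψi.integrableOn,
    add_sub_cancel]

lemma setIntegral_Ioi_id_gaussianReal (x : ℝ) :
    ∫ u in Set.Ioi x, u ∂gaussianReal 0 1 = gaussianPDFReal 0 1 x := by
  have hderiv (u : ℝ) : HasDerivAt (gaussianPDFReal 0 1) (-(u * gaussianPDFReal 0 1 u)) u := by
    simpa using hasDerivAt_gaussianPDFReal 0 1 u
  have hint : Integrable fun u ↦ -(u * gaussianPDFReal 0 1 u) :=
    ((integrable_gaussianReal_iff one_ne_zero).1 IsGaussian.integrable_id).neg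
  have hlim : Tendsto (gaussianPDFReal 0 1) atTop (𝓝 0) :=
    tendsto_zero_of_hasDerivAt_of_integrableOn_Ioi (a := x) (fun u _ ↦ hderiv u)
      hint.integrableOn (integrable_gaussianPDFReal 0 1).integrableOn
  have hIoi := integral_Ioi_of_hasDerivAt_of_tendsto' (a := x) (fun u _ ↦ hderiv u)
    hint.integrableOn hlim
  rw [integral_neg, zero_sub, neg_inj] at hIoi
  rw [← hIoi, gaussianReal_of_var_ne_zero 0 one_ne_zero,
    setIntegral_withDensity_eq_setIntegral_toReal_smul (measurable_gaussianPDF 0 1)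
      (ae_of_all _ fun _ ↦ gaussianPDF_lt_top) _ measurableSet_Ioi]
  simp only [toReal_gaussianPDF, smul_eq_mul, mul_comm]

lemma setIntegral_Iic_id_gaussianReal (x : ℝ) :
    ∫ u in Set.Iic x, u ∂gaussianReal 0 1 = -gaussianPDFReal 0 1 x := by
  have hid : Integrable (fun u : ℝ ↦ u) (gaussianReal 0 1) := IsGaussian.integrable_id
  rw [eq_neg_iff_add_eq_zero, ← setIntegral_Ioi_id_gaussianReal,
    intervalIntegral.integral_Iic_add_Ioi hid.integrableOn hid.integrableOn,
    integral_id_gaussianReal]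

variable {ψ : ℝ → ℝ}

lemma abs_mul_abs_setIntegral_gaussianReal_le (hψi : Integrable ψ (gaussianReal 0 1))
    (hψ1 : ∀ x, |ψ x| ≤ 1) {S : Set ℝ} (hS : MeasurableSet S) {x : ℝ} (hx : ∀ u ∈ S, |x| ≤ |u|) :
    |x| * |∫ u in S, ψ u ∂gaussianReal 0 1| ≤ ∫ u in S, |u| ∂gaussianReal 0 1 :=
  calc |x| * |∫ u in S, ψ u ∂gaussianReal 0 1|
      ≤ |x| * ∫ u in S, |ψ u| ∂gaussianReal 0 1 :=
        mul_le_mul_of_nonneg_left abs_integral_le_integral_abs (abs_nonneg x)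
    _ = ∫ u in S, |x| * |ψ u| ∂gaussianReal 0 1 := (integral_const_mul _ _).symm
    _ ≤ ∫ u in S, |u| ∂gaussianReal 0 1 :=
        setIntegral_mono_on (hψi.abs.const_mul _).integrableOn
          IsGaussian.integrable_id.abs.integrableOn hS fun u hu ↦
            (mul_le_of_le_one_right (abs_nonneg x) (hψ1 u)).trans (hx u hu)

lemma abs_mul_abs_setIntegral_Iic_gaussianReal_le (hψi : Integrable ψ (gaussianReal 0 1))
    (hψ1 : ∀ x, |ψ x| ≤ 1) (hψ0 : ∫ x, ψ x ∂gaussianReal 0 1 = 0) (x : ℝ) :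
    |x| * |∫ u in Set.Iic x, ψ u ∂gaussianReal 0 1| ≤ gaussianPDFReal 0 1 x := by
  rcases le_total x 0 with hx | hx
  · have habs : ∀ u ∈ Set.Iic x, |u| = -u := fun u hu ↦ abs_of_nonpos (hu.trans hx)
    refine (abs_mul_abs_setIntegral_gaussianReal_le hψi hψ1 measurableSet_Iic
      fun u hu ↦ ?_).trans_eq ?_
    · rw [habs u hu, abs_of_nonpos hx]
      exact neg_le_neg hu
    · rw [setIntegral_congr_fun measurableSet_Iic habs, integral_neg,
        setIntegral_Iic_id_gaussianReal, neg_neg]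
  · have habs : ∀ u ∈ Set.Ioi x, |u| = u := fun u hu ↦ abs_of_nonneg (hx.trans hu.le)
    have hneg : ∫ u in Set.Iic x, ψ u ∂gaussianReal 0 1
        = -∫ u in Set.Ioi x, ψ u ∂gaussianReal 0 1 := by
      rw [eq_neg_iff_add_eq_zero,
        intervalIntegral.integral_Iic_add_Ioi hψi.integrableOn hψi.integrableOn, hψ0]
    rw [hneg, abs_neg]
    refine (abs_mul_abs_setIntegral_gaussianReal_le hψi hψ1 measurableSet_Ioi
      fun u hu ↦ ?_).trans_eq ?_
    · rw [habs u hu, abs_of_nonneg hx]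
      exact hu.le
    · rw [setIntegral_congr_fun measurableSet_Ioi habs, setIntegral_Ioi_id_gaussianReal]

lemma lipschitzWith_of_hasDerivAt_of_abs_le {f f' : ℝ → ℝ} {C : ℝ≥0}
    (hf : ∀ x, HasDerivAt f (f' x) x) (hC : ∀ x, |f' x| ≤ C) : LipschitzWith C f :=
  lipschitzWith_of_nnnorm_deriv_le (fun x ↦ (hf x).differentiableAt) fun x ↦ by
    rw [(hf x).deriv]
    exact hC x

theorem exists_isSteinSolution_of_mem_Icc {h : ℝ → ℝ} (hc : Continuous h)
    (hh : ∀ x, h x ∈ Set.Icc 0 1) : ∃ f, IsSteinSolution f h ∧ LipschitzWith 2 f := by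
  have hhi : Integrable h (gaussianReal 0 1) :=
    .of_bound hc.aestronglyMeasurable 1 (ae_of_all _ fun x ↦ by
      simpa [abs_of_nonneg (hh x).1] using (hh x).2)
  set ψ : ℝ → ℝ := fun x ↦ h x - ∫ z, h z ∂gaussianReal 0 1
  set e := gaussianPDFReal 0 1
  set I : ℝ → ℝ := fun x ↦ ∫ u in Set.Iic x, ψ u ∂gaussianReal 0 1
  have he (x : ℝ) : 0 < e x := gaussianPDFReal_pos 0 1 x one_ne_zero
  have hψi : Integrable ψ (gaussianReal 0 1) := hhi.sub (integrable_const _)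
  have hψ0 : ∫ x, ψ x ∂gaussianReal 0 1 = 0 := by
    rw [integral_sub hhi (integrable_const _)]
    simp
  have hψ1 (x : ℝ) : |ψ x| ≤ 1 := by
    have hmean : ∫ z, h z ∂gaussianReal 0 1 ∈ Set.Icc 0 1 :=
      (convex_Icc 0 1).integral_mem isClosed_Icc (ae_of_all _ hh) hhi
    exact abs_le.2 ⟨by linarith [(hh x).1, hmean.2], by linarith [(hh x).2, hmean.1]⟩
  have hf (x : ℝ) : HasDerivAt (fun x ↦ I x / e x) (x * (I x / e x) + ψ x) x := by
    have hI : HasDerivAt I (ψ x * e x) x :=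
      hasDerivAt_setIntegral_Iic_gaussianReal one_ne_zero (by fun_prop) hψi x
    have he' : HasDerivAt e (-(x * e x)) x := by simpa using hasDerivAt_gaussianPDFReal 0 1 x
    refine (hI.div he' (he x).ne').congr_deriv ?_
    field [(he x).ne']
  refine ⟨_, hf, lipschitzWith_of_hasDerivAt_of_abs_le hf fun x ↦ ?_⟩
  have hxI : |x * (I x / e x)| ≤ 1 := by
    rw [abs_mul, abs_div, abs_of_pos (he x), ← mul_div_assoc, div_le_one (he x)]
    exact abs_mul_abs_setIntegral_Iic_gaussianReal_le hψi hψ1 hψ0 x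
  calc |x * (I x / e x) + ψ x| ≤ |x * (I x / e x)| + |ψ x| := abs_add_le _ _
    _ ≤ 1 + 1 := add_le_add hxI (hψ1 x)
    _ = (2 : ℝ≥0) := by norm_num

end BoundedTestFunction

section LipschitzTestFunction

lemma memLp_comp_of_lipschitzWith {α : Type*} [MeasurableSpace α] {μ : Measure α}
    [IsFiniteMeasure μ] {p : ℝ≥0∞} {Y : α → ℝ} {h : ℝ → ℝ} {L : ℝ≥0} (hL : LipschitzWith L h)
    (hY : MemLp Y p μ) : MemLp (fun ω ↦ h (Y ω)) p μ := by
  have hL₀ : LipschitzWith L fun x ↦ h x - h 0 := by simpa using hL.sub (.const (h 0))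
  exact ((hL₀.comp_memLp (sub_self _) hY).add (memLp_const (h 0))).ae_eq
    (ae_of_all _ fun ω ↦ sub_add_cancel (h (Y ω)) (h 0))

local notation "ν" => Measure.prod (volume.restrict (Set.Ioc 0 (Real.pi / 2))) (gaussianReal 0 1)

variable {h : ℝ → ℝ} {L : ℝ≥0}

lemma memLp_cos_mul_add_sin_mul (x : ℝ) :
    MemLp (fun p : ℝ × ℝ ↦ Real.cos p.1 * x + Real.sin p.1 * p.2) 2 ν := by
  have hcos : MemLp (fun p : ℝ × ℝ ↦ Real.cos p.1 * x) 2 ν :=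
    .of_bound (by fun_prop) |x| (ae_of_all _ fun p ↦ by
      rw [norm_mul]
      exact mul_le_of_le_one_left (abs_nonneg x) (Real.abs_cos_le_one _))
  have hsin : MemLp (fun p : ℝ × ℝ ↦ Real.sin p.1 * p.2) 2 ν :=
    (IsGaussian.memLp_two_id.comp_snd _).of_le (by fun_prop) (ae_of_all _ fun p ↦ by
      rw [norm_mul]
      exact mul_le_of_le_one_left (norm_nonneg _) (Real.abs_sin_le_one _))
  exact hcos.add hsin

lemma integrable_mul_deriv_comp_cos_mul_add_sin_mul (hh : ContDiff ℝ 1 h) (hL : LipschitzWith L h)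
    {w : ℝ × ℝ → ℝ} (hw : Integrable w ν) (x : ℝ) :
    Integrable (fun p ↦ w p * deriv h (Real.cos p.1 * x + Real.sin p.1 * p.2)) ν :=
  have := hh.continuous_deriv le_rfl
  hw.mul_bdd (c := L) (by fun_prop) (ae_of_all _ fun _ ↦ norm_deriv_le_of_lipschitz hL)

lemma integrable_cos_mul_snd : Integrable (fun p : ℝ × ℝ ↦ Real.cos p.1 * p.2) ν :=
  (IsGaussian.integrable_id.comp_snd _).bdd_mul (c := 1) (by fun_prop)
    (ae_of_all _ fun p ↦ Real.abs_cos_le_one p.1)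

lemma integrable_sin_fst : Integrable (fun p : ℝ × ℝ ↦ Real.sin p.1) ν :=
  .of_bound (by fun_prop) 1 (ae_of_all _ fun p ↦ Real.abs_sin_le_one p.1)

lemma integrable_snd_mul_comp_cos_mul_add_sin_mul (hL : LipschitzWith L h) (x : ℝ) :
    Integrable (fun p ↦ p.2 * h (Real.cos p.1 * x + Real.sin p.1 * p.2)) ν :=
  (IsGaussian.memLp_two_id.comp_snd _).integrable_mul
    (memLp_comp_of_lipschitzWith hL (memLp_cos_mul_add_sin_mul x))

lemma hasDerivAt_integral_snd_mul_comp (hh : ContDiff ℝ 1 h) (hL : LipschitzWith L h) (x : ℝ) :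
    HasDerivAt (fun x ↦ ∫ p, p.2 * h (Real.cos p.1 * x + Real.sin p.1 * p.2) ∂ν)
      (∫ p, Real.cos p.1 * p.2 * deriv h (Real.cos p.1 * x + Real.sin p.1 * p.2) ∂ν) x := by
  have := hh.continuous
  refine (hasDerivAt_integral_of_dominated_loc_of_deriv_le (μ := ν) (x₀ := x)
    (F' := fun x p ↦ Real.cos p.1 * p.2 * deriv h (Real.cos p.1 * x + Real.sin p.1 * p.2))
    (bound := fun p ↦ ‖Real.cos p.1 * p.2‖ * L) univ_mem
    (Eventually.of_forall fun y ↦ by fun_prop)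
    (integrable_snd_mul_comp_cos_mul_add_sin_mul hL x)
    (integrable_mul_deriv_comp_cos_mul_add_sin_mul hh hL integrable_cos_mul_snd x).1
    (ae_of_all _ fun p y _ ↦ ?_) (integrable_cos_mul_snd.norm.mul_const _)
    (ae_of_all _ fun p y _ ↦ ?_)).2
  · rw [norm_mul]
    exact mul_le_mul_of_nonneg_left (norm_deriv_le_of_lipschitz hL) (norm_nonneg _)
  · have hlin : HasDerivAt (fun y ↦ Real.cos p.1 * y + Real.sin p.1 * p.2) (Real.cos p.1) y := by
      simpa using ((hasDerivAt_id y).const_mul (Real.cos p.1)).add_const (Real.sin p.1 * p.2)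
    exact (((hh.differentiable one_ne_zero _).hasDerivAt.comp y hlin).const_mul p.2).congr_deriv
      (by ring)

lemma integral_mul_comp_const_add_mul_gaussianReal (hh : ContDiff ℝ 1 h) (hL : LipschitzWith L h)
    (a b : ℝ) : ∫ z, z * h (a + b * z) ∂gaussianReal 0 1
      = ∫ z, b * deriv h (a + b * z) ∂gaussianReal 0 1 := by
  have := hh.continuous_deriv le_rfl
  have hg (z : ℝ) : HasDerivAt (fun z ↦ h (a + b * z)) (b * deriv h (a + b * z)) z := by
    have hlin : HasDerivAt (fun z ↦ a + b * z) b z := by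
      simpa using ((hasDerivAt_id z).const_mul b).const_add a
    exact ((hh.differentiable one_ne_zero _).hasDerivAt.comp z hlin).congr_deriv (mul_comm _ _)
  have hgL : MemLp (fun z ↦ h (a + b * z)) 2 (gaussianReal 0 1) :=
    memLp_comp_of_lipschitzWith hL ((memLp_const a).add (IsGaussian.memLp_two_id.const_mul b))
  have hIBP := integral_sub_mul_gaussianReal (μ := 0) (v := 1) hg (hgL.integrable one_le_two)
    (Integrable.of_bound (by fun_prop) (|b| * L) (ae_of_all _ fun z ↦ by
      rw [norm_mul, Real.norm_eq_abs b]
      exact mul_le_mul_of_nonneg_left (norm_deriv_le_of_lipschitz hL) (abs_nonneg b)))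
    (by simpa using! IsGaussian.memLp_two_id.integrable_mul hgL)
  simpa using hIBP

lemma integral_snd_mul_comp (hh : ContDiff ℝ 1 h) (hL : LipschitzWith L h) (x : ℝ) :
    ∫ p, p.2 * h (Real.cos p.1 * x + Real.sin p.1 * p.2) ∂ν
      = ∫ p, Real.sin p.1 * deriv h (Real.cos p.1 * x + Real.sin p.1 * p.2) ∂ν := by
  rw [integral_prod _ (integrable_snd_mul_comp_cos_mul_add_sin_mul hL x), integral_prod _
    (integrable_mul_deriv_comp_cos_mul_add_sin_mul hh hL integrable_sin_fst x)]
  simp only [integral_mul_comp_const_add_mul_gaussianReal hh hL]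

lemma intervalIntegral_deriv_comp_cos_mul_add_sin_mul (hh : ContDiff ℝ 1 h) (x z : ℝ) :
    ∫ θ in 0..Real.pi / 2, (Real.cos θ * z - Real.sin θ * x)
      * deriv h (Real.cos θ * x + Real.sin θ * z) = h z - h x := by
  have := hh.continuous_deriv le_rfl
  have hderiv (θ : ℝ) : HasDerivAt (fun θ ↦ h (Real.cos θ * x + Real.sin θ * z))
      ((Real.cos θ * z - Real.sin θ * x) * deriv h (Real.cos θ * x + Real.sin θ * z)) θ := by
    have hrot : HasDerivAt (fun θ ↦ Real.cos θ * x + Real.sin θ * z)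
        (-Real.sin θ * x + Real.cos θ * z) θ :=
      ((Real.hasDerivAt_cos θ).mul_const x).add ((Real.hasDerivAt_sin θ).mul_const z)
    exact ((hh.differentiable one_ne_zero _).hasDerivAt.comp θ hrot).congr_deriv (by ring)
  rw [intervalIntegral.integral_eq_sub_of_hasDerivAt (fun θ _ ↦ hderiv θ)
    (Continuous.intervalIntegrable (by fun_prop) _ _)]
  simp

lemma integral_cos_mul_snd_sub_sin_mul_deriv_comp (hh : ContDiff ℝ 1 h) (hL : LipschitzWith L h)
    (x : ℝ) : ∫ p, (Real.cos p.1 * p.2 - Real.sin p.1 * x)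
        * deriv h (Real.cos p.1 * x + Real.sin p.1 * p.2) ∂ν
      = (∫ z, h z ∂gaussianReal 0 1) - h x := by
  have hrot : Integrable (fun p : ℝ × ℝ ↦ Real.cos p.1 * p.2 - Real.sin p.1 * x) ν :=
    integrable_cos_mul_snd.sub (integrable_sin_fst.mul_const x)
  rw [integral_prod_symm _ (integrable_mul_deriv_comp_cos_mul_add_sin_mul hh hL hrot x)]
  simp_rw [← intervalIntegral.integral_of_le Real.pi_div_two_pos.le,
    intervalIntegral_deriv_comp_cos_mul_add_sin_mul hh]
  have hhi : Integrable h (gaussianReal 0 1) :=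
    (memLp_comp_of_lipschitzWith hL IsGaussian.memLp_two_id).integrable one_le_two
  rw [integral_sub hhi (integrable_const _)]
  simp

lemma integral_abs_gaussianReal_le : ∫ z, |z| ∂gaussianReal 0 1 ≤ 1 := by
  have hsq : Integrable (fun z : ℝ ↦ z ^ 2) (gaussianReal 0 1) :=
    IsGaussian.memLp_two_id.integrable_sq
  have hsq_eq : ∫ z, z ^ 2 ∂gaussianReal 0 1 = 1 := by
    have hvar := variance_of_integral_eq_zero (μ := gaussianReal 0 1) aemeasurable_id
      integral_id_gaussianReal
    simpa [variance_id_gaussianReal] using hvar.symm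
  calc ∫ z, |z| ∂gaussianReal 0 1 ≤ ∫ z, (z ^ 2 + 1) / 2 ∂gaussianReal 0 1 :=
        integral_mono IsGaussian.integrable_id.abs ((hsq.add (integrable_const 1)).div_const 2)
          fun z ↦ by nlinarith [sq_nonneg (|z| - 1), sq_abs z]
    _ = 1 := by
        rw [integral_div, integral_add hsq (integrable_const 1), hsq_eq]
        simp

lemma abs_integral_cos_mul_snd_mul_deriv_comp_le (hL : LipschitzWith L h) (x : ℝ) :
    |∫ p, Real.cos p.1 * p.2 * deriv h (Real.cos p.1 * x + Real.sin p.1 * p.2) ∂ν| ≤ L := by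
  have hcos : ∫ θ in Set.Ioc 0 (Real.pi / 2), |Real.cos θ| = 1 := by
    have habs : ∀ θ ∈ Set.Ioc 0 (Real.pi / 2), |Real.cos θ| = Real.cos θ := fun θ hθ ↦ abs_of_nonneg
      (Real.cos_nonneg_of_neg_pi_div_two_le_of_le (by linarith [hθ.1, Real.pi_pos]) hθ.2)
    rw [setIntegral_congr_fun measurableSet_Ioc habs,
      ← intervalIntegral.integral_of_le Real.pi_div_two_pos.le, integral_cos]
    simp
  calc |∫ p, Real.cos p.1 * p.2 * deriv h (Real.cos p.1 * x + Real.sin p.1 * p.2) ∂ν|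
      ≤ ∫ p, |Real.cos p.1 * p.2| * L ∂ν := by
        rw [← Real.norm_eq_abs]
        refine norm_integral_le_of_norm_le (integrable_cos_mul_snd.abs.mul_const _)
          (ae_of_all _ fun p ↦ ?_)
        rw [norm_mul, Real.norm_eq_abs]
        exact mul_le_mul_of_nonneg_left (norm_deriv_le_of_lipschitz hL) (abs_nonneg _)
    _ = (∫ z, |z| ∂gaussianReal 0 1) * L := by
        simp_rw [abs_mul]
        rw [integral_mul_const, integral_prod_mul (fun θ : ℝ ↦ |Real.cos θ|) (fun z : ℝ ↦ |z|),
          hcos, one_mul]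
    _ ≤ L := mul_le_of_le_one_left L.2 integral_abs_gaussianReal_le

theorem exists_isSteinSolution_of_lipschitzWith (hh : ContDiff ℝ 1 h) (hL : LipschitzWith L h) :
    ∃ f, IsSteinSolution f h ∧ LipschitzWith L f := by
  have hderiv (x : ℝ) := (hasDerivAt_integral_snd_mul_comp hh hL x).neg
  refine ⟨_, fun x ↦ (hderiv x).congr_deriv ?_,
    lipschitzWith_of_hasDerivAt_of_abs_le hderiv fun x ↦ ?_⟩
  · have hsplit := integral_cos_mul_snd_sub_sin_mul_deriv_comp hh hL x
    simp_rw [sub_mul, mul_right_comm _ x] at hsplit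
    rw [integral_sub (integrable_mul_deriv_comp_cos_mul_add_sin_mul hh hL integrable_cos_mul_snd x)
      ((integrable_mul_deriv_comp_cos_mul_add_sin_mul hh hL integrable_sin_fst x).mul_const x),
      integral_mul_const, ← integral_snd_mul_comp hh hL x] at hsplit
    simp only [Pi.neg_apply]
    linarith
  · rw [abs_neg]
    exact abs_integral_cos_mul_snd_mul_deriv_comp_le hL x

end LipschitzTestFunction

section SteinMethod

lemma map_const_add_mul_gaussianReal (m s : ℝ) :
    (gaussianReal 0 1).map (fun z ↦ m + s * z) = gaussianReal m (s ^ 2).toNNReal := by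
  have hmap := gaussianReal_map_const_add (μ := s * 0) (v := .mk (s ^ 2) (sq_nonneg _) * 1) m
  rw [← gaussianReal_map_const_mul, Measure.map_map (by fun_prop) (by fun_prop)] at hmap
  refine hmap.trans ?_
  rw [mul_zero, zero_add, mul_one, Real.toNNReal_of_nonneg (sq_nonneg s)]

namespace HasSteinDiscrepancyLE

variable {Ω : Type*} [MeasurableSpace Ω] {P : Measure Ω} [IsProbabilityMeasure P] {F : Ω → ℝ}
  {m s κ : ℝ}

lemma const_mul_add_const (hF : HasSteinDiscrepancyLE F P κ) (hF2 : MemLp F 2 P) (a b : ℝ) :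
    HasSteinDiscrepancyLE (fun ω ↦ a * F ω + b) P (a ^ 2 * κ) := by
  intro M h hh hM
  have hF1 : Integrable F P := hF2.integrable one_le_two
  have haffine : LipschitzWith ‖a‖₊ fun x ↦ a * x + b :=
    lipschitzWith_of_hasDerivAt_of_abs_le (fun x ↦ by
      simpa using ((hasDerivAt_id x).const_mul a).add_const b) fun _ ↦ le_rfl
  have hderiv (x : ℝ) : deriv (fun x ↦ h (a * x + b)) x = a * deriv h (a * x + b) := by
    rw [deriv_comp_mul_left a (fun x ↦ h (x + b)), deriv_comp_add_const, smul_eq_mul]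
  have hdisc := hF (M * ‖a‖₊) (fun x ↦ h (a * x + b)) (hh.comp (by fun_prop)) (hM.comp haffine)
  have hcov : cov[h ∘ fun ω ↦ a * F ω + b, fun ω ↦ a * F ω + b; P]
      = a * cov[fun ω ↦ h (a * F ω + b), F; P] := by
    rw [covariance_add_const_right (hF1.const_mul a), covariance_const_mul_right]
    rfl
  have hvar : Var[fun ω ↦ a * F ω + b; P] = a ^ 2 * Var[F; P] := by
    rw [variance_add_const (hF1.const_mul a).1, variance_const_mul]
  simp_rw [hderiv, integral_const_mul] at hdisc
  calc _ = |a| * |cov[fun ω ↦ h (a * F ω + b), F; P]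
          - Var[F; P] * (a * ∫ ω, deriv h (a * F ω + b) ∂P)| := by
        rw [hcov, hvar, ← abs_mul]
        congr 1
        ring
    _ ≤ |a| * ((M * ‖a‖₊ : ℝ≥0) * κ) := mul_le_mul_of_nonneg_left hdisc (abs_nonneg a)
    _ = M * (a ^ 2 * κ) := by
        rw [NNReal.coe_mul, coe_nnnorm, Real.norm_eq_abs, ← sq_abs a]
        ring

lemma abs_integral_comp_sub_integral_le {Y : Ω → ℝ} (hY : HasSteinDiscrepancyLE Y P κ)
    (hY2 : MemLp Y 2 P) (hmean : ∫ ω, Y ω ∂P = 0) (hvar : Var[Y; P] = 1) {f h : ℝ → ℝ} {B : ℝ≥0}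
    (hh : Continuous h) (hf : IsSteinSolution f h) (hB : LipschitzWith B f) :
    |∫ ω, h (Y ω) ∂P - ∫ z, h z ∂gaussianReal 0 1| ≤ B * κ := by
  set c := ∫ z, h z ∂gaussianReal 0 1
  have hderiv (x : ℝ) : deriv f x = x * f x + (h x - c) := (hf x).deriv
  have hfC : ContDiff ℝ 1 f := by
    refine contDiff_one_iff_deriv.2 ⟨fun x ↦ (hf x).differentiableAt, ?_⟩
    have := hB.continuous
    rw [funext hderiv]
    fun_prop
  have hfY : MemLp (f ∘ Y) 2 P := memLp_comp_of_lipschitzWith hB hY2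
  have hYf : Integrable (fun ω ↦ f (Y ω) * Y ω) P := hfY.integrable_mul hY2
  have hf'Y : Integrable (fun ω ↦ deriv f (Y ω)) P :=
    .of_bound ((hfC.continuous_deriv le_rfl).comp_aestronglyMeasurable hY2.1) B
      (ae_of_all _ fun _ ↦ norm_deriv_le_of_lipschitz hB)
  have hcov : cov[f ∘ Y, Y; P] = ∫ ω, f (Y ω) * Y ω ∂P := by
    rw [covariance_eq_integral_mul_sub hfY hY2, hmean]
    simp
  have hhY : ∫ ω, h (Y ω) ∂P = ∫ ω, deriv f (Y ω) ∂P - ∫ ω, f (Y ω) * Y ω ∂P + c :=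
    calc ∫ ω, h (Y ω) ∂P = ∫ ω, deriv f (Y ω) - f (Y ω) * Y ω + c ∂P := by
          simp only [hderiv, mul_comm, add_sub_cancel_left, sub_add_cancel]
      _ = _ := by
          rw [integral_add (by exact hf'Y.sub hYf) (integrable_const c), integral_sub hf'Y hYf]
          simp
  have hdisc := hY B f hfC hB
  rw [hvar, one_mul, hcov, abs_sub_comm] at hdisc
  rwa [hhY, add_sub_cancel_right]

theorem abs_integral_comp_sub_integral_gaussianReal_le (hF : HasSteinDiscrepancyLE F P κ)
    (hF2 : MemLp F 2 P) (hs : 0 < s) (hmean : ∫ ω, F ω ∂P = m) (hvar : Var[F; P] = s ^ 2)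
    {f φ : ℝ → ℝ} {B : ℝ≥0} (hφ : Continuous φ) (hf : IsSteinSolution f fun z ↦ φ (m + s * z))
    (hB : LipschitzWith B f) :
    |∫ ω, φ (F ω) ∂P - ∫ x, φ x ∂gaussianReal m (s ^ 2).toNNReal| ≤ B * (κ / s ^ 2) := by
  set Y : Ω → ℝ := fun ω ↦ s⁻¹ * F ω + -(s⁻¹ * m)
  have hF1 : Integrable F P := hF2.integrable one_le_two
  have hFY (ω : Ω) : m + s * Y ω = F ω := by
    simp only [Y]
    field
  have hY : HasSteinDiscrepancyLE Y P (κ / s ^ 2) := by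
    rw [div_eq_inv_mul, ← inv_pow]
    exact hF.const_mul_add_const hF2 _ _
  have hYmean : ∫ ω, Y ω ∂P = 0 := by
    rw [integral_add (hF1.const_mul _) (integrable_const _), integral_const_mul, hmean]
    simp
  have hYvar : Var[Y; P] = 1 := by
    rw [variance_add_const (hF1.const_mul _).1, variance_const_mul, hvar]
    field
  have hY2 : MemLp Y 2 P := (hF2.const_mul _).add (memLp_const _)
  rw [← map_const_add_mul_gaussianReal, integral_map (by fun_prop) hφ.aestronglyMeasurable]
  simpa only [hFY] using
    hY.abs_integral_comp_sub_integral_le hY2 hYmean hYvar (by fun_prop) hf hB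

end HasSteinDiscrepancyLE

end SteinMethod

lemma exists_contDiff_lipschitzWith_forall_norm_sub_le {E F : Type*} [NormedAddCommGroup E]
    [NormedSpace ℝ E] [FiniteDimensional ℝ E] [NormedAddCommGroup F] [NormedSpace ℝ F]
    [CompleteSpace F] {f : E → F} {L : ℝ≥0} (hf : LipschitzWith L f) {ε : ℝ} (hε : 0 < ε) :
    ∃ φ : E → F, ContDiff ℝ 1 φ ∧ LipschitzWith L φ ∧ ∀ x, ‖φ x - f x‖ ≤ L * ε := by
  borelize E
  let μ : Measure E := Measure.addHaar
  let ρ : ContDiffBump (0 : E) := ⟨ε / 2, ε, half_pos hε, half_lt_self hε⟩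
  have hex : ConvolutionExists (ρ.normed μ) f (.lsmul ℝ ℝ) μ :=
    ρ.hasCompactSupport_normed.convolutionExists_left _ ρ.continuous_normed
      hf.continuous.locallyIntegrable
  refine ⟨convolution (ρ.normed μ) f (.lsmul ℝ ℝ) μ,
    ρ.hasCompactSupport_normed.contDiff_convolution_left _ ρ.contDiff_normed
      hf.continuous.locallyIntegrable, LipschitzWith.of_dist_le_mul fun x y ↦ ?_, fun x ↦ ?_⟩
  · rw [dist_eq_norm, convolution_def, convolution_def, ← integral_sub (hex x) (hex y)]
    calc _ ≤ ∫ t, ρ.normed μ t * (L * dist x y) ∂μ := by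
          refine norm_integral_le_of_norm_le (ρ.integrable_normed.mul_const _)
            (ae_of_all _ fun t ↦ ?_)
          simp only [ContinuousLinearMap.lsmul_apply, ← smul_sub]
          rw [norm_smul, Real.norm_of_nonneg (ρ.nonneg_normed t), ← dist_eq_norm,
            ← dist_sub_right x y t]
          exact mul_le_mul_of_nonneg_left (hf.dist_le_mul _ _) (ρ.nonneg_normed t)
      _ = L * dist x y := by rw [integral_mul_const, ρ.integral_normed, one_mul]
  · rw [← dist_eq_norm]
    exact ContDiffBump.dist_normed_convolution_le hf.continuous.aestronglyMeasurable fun y hy ↦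
      (hf.dist_le_mul y x).trans (mul_le_mul_of_nonneg_left (Metric.mem_ball.1 hy).le L.2)

lemma integrable_of_lipschitzWith {μ : Measure ℝ} [IsFiniteMeasure μ] (hμ : Integrable id μ)
    {f : ℝ → ℝ} {L : ℝ≥0} (hf : LipschitzWith L f) : Integrable f μ :=
  memLp_one_iff_integrable.1 (memLp_comp_of_lipschitzWith hf (memLp_one_iff_integrable.2 hμ))

lemma wassersteinDist_le_of_forall_contDiff {μ ν : Measure ℝ} [IsProbabilityMeasure μ]
    [IsProbabilityMeasure ν] (hμ : Integrable id μ) (hν : Integrable id ν) {C : ℝ}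
    (h : ∀ φ : ℝ → ℝ, ContDiff ℝ 1 φ → LipschitzWith 1 φ → |∫ x, φ x ∂μ - ∫ x, φ x ∂ν| ≤ C) :
    wassersteinDist μ ν ≤ ENNReal.ofReal C := by
  refine iSup₂_le fun f hf ↦ ENNReal.ofReal_le_ofReal (le_of_forall_pos_le_add fun ε hε ↦ ?_)
  obtain ⟨φ, hφ, hφL, hφf⟩ := exists_contDiff_lipschitzWith_forall_norm_sub_le hf (half_pos hε)
  have happrox {ρ : Measure ℝ} [IsProbabilityMeasure ρ] (hρ : Integrable id ρ) :
      |∫ x, φ x ∂ρ - ∫ x, f x ∂ρ| ≤ ε / 2 := by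
    rw [← integral_sub (integrable_of_lipschitzWith hρ hφL) (integrable_of_lipschitzWith hρ hf)]
    simpa using norm_integral_le_of_norm_le_const (μ := ρ) (ae_of_all _ hφf)
  have hφC := abs_le.1 (h φ hφ hφL)
  have hμ' := abs_le.1 (happrox hμ)
  have hν' := abs_le.1 (happrox hν)
  exact abs_le.2 ⟨by linarith, by linarith⟩

lemma exists_continuous_mem_Icc_integral_abs_indicator_sub_le {α : Type*} [TopologicalSpace α]
    [NormalSpace α] [MeasurableSpace α] [BorelSpace α] (μ : Measure α) [IsFiniteMeasure μ]
    [μ.WeaklyRegular] {A : Set α} (hA : MeasurableSet A) {ε : ℝ} (hε : 0 < ε) :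
    ∃ φ : α → ℝ, Continuous φ ∧ (∀ x, φ x ∈ Set.Icc 0 1) ∧
      ∫ x, |A.indicator 1 x - φ x| ∂μ ≤ ε := by
  have hAi : Integrable (A.indicator (1 : α → ℝ)) μ := (integrable_const 1).indicator hA
  obtain ⟨g, hg, hgi⟩ := hAi.exists_boundedContinuous_integral_sub_le hε
  have hcont : Continuous fun x ↦ (Set.projIcc (0 : ℝ) 1 zero_le_one (g x) : ℝ) := by
    have := g.continuous
    fun_prop
  refine ⟨_, hcont, fun x ↦ Subtype.coe_prop _, le_trans ?_ hg⟩
  refine integral_mono_of_nonneg (ae_of_all _ fun _ ↦ abs_nonneg _) (hAi.sub hgi).norm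
    (ae_of_all _ fun x ↦ ?_)
  have hmem : A.indicator (1 : α → ℝ) x ∈ Set.Icc 0 1 := by
    by_cases hx : x ∈ A <;> simp [hx]
  calc |A.indicator 1 x - (Set.projIcc (0 : ℝ) 1 zero_le_one (g x) : ℝ)|
      = dist (Set.projIcc (0 : ℝ) 1 zero_le_one (A.indicator 1 x))
          (Set.projIcc 0 1 zero_le_one (g x)) := by
        rw [Set.projIcc_of_mem _ hmem, Subtype.dist_eq, Real.dist_eq]
    _ ≤ ‖A.indicator (1 : α → ℝ) x - g x‖ := by
        simpa [dist_eq_norm] using (LipschitzWith.projIcc zero_le_one).dist_le_mul _ (g x)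

lemma tvDist_le_of_forall_continuous {μ ν : Measure ℝ} [IsFiniteMeasure μ] [IsFiniteMeasure ν]
    {C : ℝ} (h : ∀ φ : ℝ → ℝ, Continuous φ → (∀ x, φ x ∈ Set.Icc 0 1) →
      |∫ x, φ x ∂μ - ∫ x, φ x ∂ν| ≤ C) : tvDist μ ν ≤ ENNReal.ofReal C := by
  refine iSup₂_le fun A hA ↦ ENNReal.ofReal_le_ofReal (le_of_forall_pos_le_add fun ε hε ↦ ?_)
  obtain ⟨φ, hφ, hφ01, hφA⟩ :=
    exists_continuous_mem_Icc_integral_abs_indicator_sub_le (μ + ν) hA hε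
  have hAi (ρ : Measure ℝ) [IsFiniteMeasure ρ] : Integrable (A.indicator (1 : ℝ → ℝ)) ρ :=
    (integrable_const 1).indicator hA
  have hφi (ρ : Measure ℝ) [IsFiniteMeasure ρ] : Integrable φ ρ :=
    .of_bound hφ.aestronglyMeasurable 1 (ae_of_all _ fun x ↦ by
      simpa [abs_of_nonneg (hφ01 x).1] using (hφ01 x).2)
  have happrox (ρ : Measure ℝ) [IsFiniteMeasure ρ] :
      |ρ.real A - ∫ x, φ x ∂ρ| ≤ ∫ x, |A.indicator 1 x - φ x| ∂ρ := by
    rw [← integral_indicator_one hA, ← integral_sub (hAi ρ) (hφi ρ)]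
    exact abs_integral_le_integral_abs
  have habs (ρ : Measure ℝ) [IsFiniteMeasure ρ] :
      Integrable (fun x ↦ |A.indicator 1 x - φ x|) ρ := ((hAi ρ).sub (hφi ρ)).abs
  rw [integral_add_measure (habs μ) (habs ν)] at hφA
  have hφC := abs_le.1 (h φ hφ hφ01)
  have hμ := abs_le.1 (happrox μ)
  have hν := abs_le.1 (happrox ν)
  exact abs_le.2 ⟨by linarith, by linarith⟩

section NormalApproximation

variable {Ω : Type*} [MeasurableSpace Ω] {P : Measure Ω} [IsProbabilityMeasure P] {F : Ω → ℝ}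
  {m s κ : ℝ}

theorem HasSteinDiscrepancyLE.wassersteinDist_le (hF : HasSteinDiscrepancyLE F P κ)
    (hF2 : MemLp F 2 P) (hs : 0 < s) (hmean : ∫ ω, F ω ∂P = m) (hvar : Var[F; P] = s ^ 2) :
    wassersteinDist (P.map F) (gaussianReal m (s ^ 2).toNNReal) ≤ ENNReal.ofReal (κ / s) := by
  have hFm : AEMeasurable F P := hF2.1.aemeasurable
  have : IsProbabilityMeasure (P.map F) := Measure.isProbabilityMeasure_map hFm
  refine wassersteinDist_le_of_forall_contDiff
    ((integrable_map_measure (by fun_prop) hFm).2 (hF2.integrable one_le_two))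
    IsGaussian.integrable_id fun φ hφ hφL ↦ ?_
  have hφs : LipschitzWith s.toNNReal fun z ↦ φ (m + s * z) :=
    LipschitzWith.of_dist_le_mul fun x y ↦ by
      simpa [hs.le, Real.dist_eq, ← mul_sub, abs_mul, abs_of_pos hs]
        using hφL.dist_le_mul (m + s * x) (m + s * y)
  obtain ⟨f, hf, hfL⟩ := exists_isSteinSolution_of_lipschitzWith (hφ.comp (by fun_prop)) hφs
  rw [integral_map hFm hφ.continuous.aestronglyMeasurable]
  refine (hF.abs_integral_comp_sub_integral_gaussianReal_le hF2 hs hmean hvar hφ.continuous hf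
    hfL).trans_eq ?_
  rw [Real.coe_toNNReal s hs.le]
  field

theorem HasSteinDiscrepancyLE.tvDist_le (hF : HasSteinDiscrepancyLE F P κ)
    (hF2 : MemLp F 2 P) (hs : 0 < s) (hmean : ∫ ω, F ω ∂P = m) (hvar : Var[F; P] = s ^ 2) :
    tvDist (P.map F) (gaussianReal m (s ^ 2).toNNReal) ≤ ENNReal.ofReal (2 * (κ / s ^ 2)) := by
  refine tvDist_le_of_forall_continuous fun φ hφ hφ01 ↦ ?_
  obtain ⟨f, hf, hfL⟩ := exists_isSteinSolution_of_mem_Icc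
    (h := fun z ↦ φ (m + s * z)) (by fun_prop) fun z ↦ hφ01 _
  rw [integral_map hF2.1.aemeasurable hφ.aestronglyMeasurable]
  exact hF.abs_integral_comp_sub_integral_gaussianReal_le hF2 hs hmean hvar hφ hf hfL

end NormalApproximation

/-! ### Contractions and partial derivatives -/

section Contraction

variable {H : Type*} [NormedAddCommGroup H] [InnerProductSpace ℝ H]

lemma norm_tmulH (a b : H) : ‖tmulH a b‖ = ‖a‖ * ‖b‖ := by
  rw [tmulH, UniformSpace.Completion.norm_coe, TensorProduct.norm_tmul]

lemma inner_tmulH (a b c d : H) : ⟪tmulH a b, tmulH c d⟫_ℝ = ⟪a, c⟫_ℝ * ⟪b, d⟫_ℝ := by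
  rw [tmulH, tmulH, UniformSpace.Completion.inner_coe, TensorProduct.inner_tmul]

variable [CompleteSpace H]

lemma inner_contractOp (T : HTensor H) (f g : H) : ⟪contractOp T f, g⟫_ℝ = ⟪T, tmulH f g⟫_ℝ := by
  rw [contractOp, InnerProductSpace.continuousLinearMapOfBilin_apply]
  rfl

lemma contractOp_sub (T S : HTensor H) : contractOp (T - S) = contractOp T - contractOp S := by
  ext f
  refine ext_inner_right ℝ fun g ↦ ?_
  simp only [sub_apply, inner_sub_left, inner_contractOp]

lemma norm_contractOp_le (T : HTensor H) : ‖contractOp T‖ ≤ ‖T‖ := by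
  refine ContinuousLinearMap.opNorm_le_bound _ (norm_nonneg _) fun f ↦ ?_
  have h : ‖contractOp T f‖ * ‖contractOp T f‖ ≤ ‖T‖ * ‖f‖ * ‖contractOp T f‖ := by
    rw [← real_inner_self_eq_norm_mul_norm, inner_contractOp, mul_assoc, ← norm_tmulH]
    exact real_inner_le_norm _ _
  rcases (norm_nonneg (contractOp T f)).eq_or_lt with h0 | h0
  · rw [← h0]
    positivity
  · exact le_of_mul_le_mul_right h h0

lemma lipschitzWith_contractOp : LipschitzWith 1 (contractOp : HTensor H → H →L[ℝ] H) :=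
  LipschitzWith.of_dist_le_mul fun T S ↦ by
    simpa [dist_eq_norm, ← contractOp_sub] using norm_contractOp_le (T - S)

end Contraction

section PartialDerivatives

variable {n : ℕ} {g : (Fin n → ℝ) → ℝ}

lemma contDiff_partialDeriv (hg : ContDiff ℝ ((⊤ : ℕ∞) : WithTop ℕ∞) g) (i : Fin n) :
    ContDiff ℝ ((⊤ : ℕ∞) : WithTop ℕ∞) (partialDeriv i g) :=
  (hg.fderiv_right (by simp)).clm_apply contDiff_const

lemma hasCompactSupport_partialDeriv (hg : HasCompactSupport g) (i : Fin n) :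
    HasCompactSupport (partialDeriv i g) :=
  hg.fderiv_apply (𝕜 := ℝ) _

lemma fderiv_eq_sum_partialDeriv (x w : Fin n → ℝ) :
    fderiv ℝ g x w = ∑ i, w i * partialDeriv i g x := by
  simpa [partialDeriv, Pi.basisFun_apply] using
    congrArg (fderiv ℝ g x) (((Pi.basisFun ℝ (Fin n)).sum_repr w).symm)

end PartialDerivatives

/-! ### The white noise of an isonormal process on a finite-dimensional subspace -/

section Isonormal

variable {H Ω : Type*} [NormedAddCommGroup H] [InnerProductSpace ℝ H]
  [MeasurableSpace Ω] {P : Measure Ω} {X : H → Ω → ℝ}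

lemma IsIsonormal.memLp (hX : IsIsonormal X P) (h : H) : MemLp (X h) 2 P :=
  (hX.gaussian.hasGaussianLaw_eval h).memLp_two

lemma IsIsonormal.integral_sq_sum {ι : Type*} [Fintype ι] (hX : IsIsonormal X P) (c : ι → ℝ)
    (φ : ι → H) : ∫ ω, (∑ i, c i * X (φ i) ω) ^ 2 ∂P = ‖∑ i, c i • φ i‖ ^ 2 := by
  have hint (i j : ι) : Integrable (fun ω ↦ c i * X (φ i) ω * (c j * X (φ j) ω)) P :=
    ((hX.memLp _).const_mul _).integrable_mul ((hX.memLp _).const_mul _)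
  simp_rw [pow_two, Finset.sum_mul_sum, ← real_inner_self_eq_norm_mul_norm, sum_inner, inner_sum]
  rw [integral_finsetSum _ fun i _ ↦ integrable_finsetSum _ fun j _ ↦ hint i j]
  refine Finset.sum_congr rfl fun i _ ↦ ?_
  rw [integral_finsetSum _ fun j _ ↦ hint i j]
  refine Finset.sum_congr rfl fun j _ ↦ ?_
  simp_rw [mul_mul_mul_comm (c i), integral_const_mul, hX.covariance, real_inner_smul_left,
    real_inner_smul_right, mul_assoc]

lemma IsIsonormal.ae_eq_sum {ι : Type*} [Fintype ι] (hX : IsIsonormal X P) (c : ι → ℝ)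
    (φ : ι → H) : ∀ᵐ ω ∂P, X (∑ i, c i • φ i) ω = ∑ i, c i * X (φ i) ω := by
  have hsq := hX.integral_sq_sum (fun o : Option ι ↦ o.elim (-1) c)
    (fun o ↦ o.elim (∑ i, c i • φ i) φ)
  simp only [Fintype.sum_option, Option.elim_none, Option.elim_some, neg_smul, one_smul,
    neg_add_cancel, norm_zero, neg_one_mul] at hsq
  have hL2 : MemLp (fun ω ↦ -X (∑ i, c i • φ i) ω + ∑ i, c i * X (φ i) ω) 2 P :=
    (hX.memLp _).neg.add (memLp_finsetSum _ fun i _ ↦ (hX.memLp _).const_mul (c i))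
  rw [zero_pow two_ne_zero, integral_eq_zero_iff_of_nonneg (fun _ ↦ sq_nonneg _)
    hL2.integrable_sq] at hsq
  filter_upwards [hsq] with ω hω
  linarith [pow_eq_zero_iff two_ne_zero |>.1 hω]

lemma IsIsonormal.map_eq_gaussianReal (hX : IsIsonormal X P) (h : H) :
    P.map (X h) = gaussianReal 0 (‖h‖ ^ 2).toNNReal := by
  have := hX.gaussian.isProbabilityMeasure
  rw [(hX.gaussian.hasGaussianLaw_eval h).map_eq_gaussianReal, hX.centered,
    variance_of_integral_eq_zero (hX.memLp h).1.aemeasurable (hX.centered h),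
    ← real_inner_self_eq_norm_sq, ← hX.covariance]
  simp_rw [pow_two]

variable {V : Submodule ℝ H} [FiniteDimensional ℝ V]

/-- The restriction to a finite-dimensional subspace `V` of the white noise attached to `X`: the
random vector of `V` whose scalar product with `v ∈ V` is almost surely `X(v)`. The process itself
need not be linear in `v` pointwise, hence the choice of an orthonormal basis. -/
noncomputable def noiseOn (V : Submodule ℝ H) [FiniteDimensional ℝ V] (X : H → Ω → ℝ) (ω : Ω) : V :=
  ∑ k, X (stdOrthonormalBasis ℝ V k) ω • stdOrthonormalBasis ℝ V k

lemma IsIsonormal.ae_inner_noiseOn (hX : IsIsonormal X P) (v : V) :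
    ∀ᵐ ω ∂P, ⟪v, noiseOn V X ω⟫_ℝ = X v ω := by
  set b := stdOrthonormalBasis ℝ V
  have hv : ∑ k, ⟪b k, v⟫_ℝ • (b k : H) = v := by
    conv_rhs => rw [← b.sum_repr' v]
    simp
  filter_upwards [hX.ae_eq_sum (fun k ↦ ⟪b k, v⟫_ℝ) (fun k ↦ (b k : H))] with ω hω
  rw [hv] at hω
  simp only [hω, noiseOn, inner_sum, real_inner_smul_right, real_inner_comm, mul_comm, b]

variable [MeasurableSpace V] [BorelSpace V]

lemma IsIsonormal.aemeasurable_noiseOn (hX : IsIsonormal X P) : AEMeasurable (noiseOn V X) P :=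
  Finset.aemeasurable_fun_sum _ fun _ _ ↦ (hX.gaussian.aemeasurable _).smul_const _

theorem IsIsonormal.map_noiseOn (hX : IsIsonormal X P) : P.map (noiseOn V X) = stdGaussian V := by
  have := hX.gaussian.isProbabilityMeasure
  have hm := hX.aemeasurable_noiseOn (V := V)
  have := Measure.isProbabilityMeasure_map hm
  refine Measure.ext_of_charFun (funext fun t ↦ ?_)
  calc charFun (P.map (noiseOn V X)) t
    _ = ∫ ω, Complex.exp (⟪noiseOn V X ω, t⟫_ℝ * Complex.I) ∂P := by
      rw [charFun_apply, integral_map hm (by fun_prop)]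
    _ = ∫ ω, Complex.exp (⟪X t ω, (1 : ℝ)⟫_ℝ * Complex.I) ∂P := by
      refine integral_congr_ae ?_
      filter_upwards [hX.ae_inner_noiseOn t] with ω hω
      rw [real_inner_comm, hω]
      simp
    _ = charFun (P.map (X t)) 1 := by
      rw [charFun_apply, integral_map (hX.gaussian.aemeasurable _) (by fun_prop)]
    _ = charFun (stdGaussian V) t := by
      rw [hX.map_eq_gaussianReal, charFun_gaussianReal, charFun_stdGaussian,
        Real.coe_toNNReal _ (sq_nonneg _), Submodule.coe_norm]
      push_cast
      ring_nf

end Isonormal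

/-! ### Cylindrical random variables -/

lemma exists_boundedContinuousFunction_eq {α : Type*} [TopologicalSpace α] {k : α → ℝ}
    (hk : Continuous k) (hkc : HasCompactSupport k) : ∃ b : α →ᵇ ℝ, ⇑b = k :=
  let ⟨C, hC⟩ := hk.bounded_above_of_compact_support hkc
  ⟨.ofNormedAddCommGroup k hk C hC, rfl⟩

lemma lpNorm_map_le_of_ae_norm_comp_le {α β E F : Type*} [MeasurableSpace α] [MeasurableSpace β]
    [NormedAddCommGroup E] [NormedAddCommGroup F] {ν : Measure α} {Y : α → β} {u : β → E}
    {v : α → F} {p : ℝ≥0∞} (hY : AEMeasurable Y ν) (hu : AEStronglyMeasurable u (ν.map Y))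
    (hv : MemLp v p ν) (huv : ∀ᵐ a ∂ν, ‖u (Y a)‖ ≤ ‖v a‖) :
    lpNorm u p (ν.map Y) ≤ lpNorm v p ν := by
  rw [← toReal_eLpNorm hu, ← toReal_eLpNorm hv.1, eLpNorm_map_measure hu hY]
  exact ENNReal.toReal_mono hv.eLpNorm_ne_top (eLpNorm_mono_ae huv)

lemma HasSteinDiscrepancyLE.of_identDistrib {α β : Type*} [MeasurableSpace α] [MeasurableSpace β]
    {μ : Measure α} {ν : Measure β} {F : α → ℝ} {G : β → ℝ} {κ : ℝ}
    (hF : HasSteinDiscrepancyLE F μ κ) (hFG : IdentDistrib F G μ ν) :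
    HasSteinDiscrepancyLE G ν κ := by
  intro M h hh hhM
  have hcov : cov[h ∘ F, F; μ] = cov[h ∘ G, G; ν] :=
    calc cov[h ∘ F, F; μ]
      _ = cov[h, id; μ.map F] := (covariance_map hhM.continuous.aestronglyMeasurable
        aestronglyMeasurable_id hFG.aemeasurable_fst).symm
      _ = cov[h ∘ G, G; ν] := by
        rw [hFG.map_eq]
        exact covariance_map hhM.continuous.aestronglyMeasurable
          aestronglyMeasurable_id hFG.aemeasurable_snd
  have hderiv : ∫ a, deriv h (F a) ∂μ = ∫ b, deriv h (G b) ∂ν :=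
    (hFG.comp (measurable_deriv h)).integral_eq
  rw [← hcov, ← hFG.variance_eq, ← hderiv]
  exact hF M h hh hhM

lemma HasSteinDiscrepancyLE.mono {α : Type*} [MeasurableSpace α] {μ : Measure α} {F : α → ℝ}
    {κ κ' : ℝ} (hF : HasSteinDiscrepancyLE F μ κ) (hκ : κ ≤ κ') : HasSteinDiscrepancyLE F μ κ' :=
  fun M h hh hhM ↦ (hF M h hh hhM).trans (mul_le_mul_of_nonneg_left hκ M.2)

namespace Cylinder

section Derivatives

variable {H Ω : Type*}

lemma exists_val_eq_comp_vec (G : Cylinder H) (X : H → Ω → ℝ) :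
    ∃ b : (Fin G.n → ℝ) →ᵇ ℝ, G.val X = b ∘ G.vec X := by
  obtain ⟨b, hb⟩ := exists_boundedContinuousFunction_eq G.smooth.continuous G.compact
  exact ⟨b, by rw [hb]; rfl⟩

lemma memLp_comp_vec [MeasurableSpace Ω] {P : Measure Ω} [IsFiniteMeasure P] {G : Cylinder H}
    {X : H → Ω → ℝ} (hX : ∀ h, AEMeasurable (X h) P) {E : Type*} [NormedAddCommGroup E]
    (b : (Fin G.n → ℝ) →ᵇ E) (p : ℝ≥0∞) : MemLp (b ∘ G.vec X) p P :=
  .of_bound (b.continuous.comp_aestronglyMeasurable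
    (aemeasurable_pi_lambda _ fun _ ↦ hX _).aestronglyMeasurable) ‖b‖
    (ae_of_all _ fun _ ↦ b.norm_coe_le_norm _)

lemma memLp_val [MeasurableSpace Ω] {P : Measure Ω} [IsFiniteMeasure P] (G : Cylinder H)
    {X : H → Ω → ℝ} (hX : ∀ h, AEMeasurable (X h) P) (p : ℝ≥0∞) : MemLp (G.val X) p P := by
  obtain ⟨b, hb⟩ := G.exists_val_eq_comp_vec X
  exact hb ▸ memLp_comp_vec hX b p

variable [NormedAddCommGroup H] [InnerProductSpace ℝ H]

lemma exists_D_eq_comp_vec (G : Cylinder H) (X : H → Ω → ℝ) :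
    ∃ b : (Fin G.n → ℝ) →ᵇ H, G.D X = b ∘ G.vec X := by
  choose b hb using fun i ↦ exists_boundedContinuousFunction_eq
    (contDiff_partialDeriv G.smooth i).continuous (hasCompactSupport_partialDeriv G.compact i)
  refine ⟨∑ i, pointwiseBilin (.lsmul ℝ ℝ) (b i) (.const _ (G.φ i)), funext fun ω ↦ ?_⟩
  simp [D, pointwiseBilin_apply, hb]

lemma exists_D2_eq_comp_vec (G : Cylinder H) (X : H → Ω → ℝ) :
    ∃ b : (Fin G.n → ℝ) →ᵇ HTensor H, G.D2 X = b ∘ G.vec X := by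
  choose b hb using fun i j ↦ exists_boundedContinuousFunction_eq
    (contDiff_partialDeriv (contDiff_partialDeriv G.smooth j) i).continuous
    (hasCompactSupport_partialDeriv (hasCompactSupport_partialDeriv G.compact j) i)
  refine ⟨∑ i, ∑ j, pointwiseBilin (.lsmul ℝ ℝ) (b i j) (.const _ (tmulH (G.φ i) (G.φ j))),
    funext fun ω ↦ ?_⟩
  simp [D2, pointwiseBilin_apply, hb]

lemma contractOp_D2_apply [CompleteSpace H] (G : Cylinder H) (X : H → Ω → ℝ) (ω : Ω) (v : H) :
    contractOp (G.D2 X ω) v = ∑ i, ∑ j,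
      partialDeriv i (partialDeriv j G.g) (G.vec X ω) • ⟪G.φ i, v⟫_ℝ • G.φ j := by
  refine ext_inner_right ℝ fun w ↦ ?_
  simp only [inner_contractOp, D2, sum_inner, real_inner_smul_left, inner_tmulH]

end Derivatives

section StandardGaussian

variable {E : Type*} [NormedAddCommGroup E] [InnerProductSpace ℝ E] (G : Cylinder E)

lemma continuous_vec_inner : Continuous (G.vec (inner ℝ)) :=
  continuous_pi fun _ ↦ continuous_const.inner continuous_id

lemma hasFDerivAt_comp_vec_inner {k : (Fin G.n → ℝ) → ℝ} (hk : Differentiable ℝ k) (x : E) :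
    HasFDerivAt (fun x ↦ k (G.vec (inner ℝ) x))
      (∑ i, partialDeriv i k (G.vec (inner ℝ) x) • innerSL ℝ (G.φ i)) x := by
  have hvec : HasFDerivAt (G.vec (inner ℝ)) (.pi fun i ↦ innerSL ℝ (G.φ i)) x :=
    (ContinuousLinearMap.pi fun i ↦ innerSL ℝ (G.φ i)).hasFDerivAt
  refine ((hk _).hasFDerivAt.comp x hvec).congr_fderiv ?_
  ext w
  simp [fderiv_eq_sum_partialDeriv, mul_comm]

variable [CompleteSpace E]

lemma hasGradientAt_val_inner (x : E) :
    HasGradientAt (G.val (inner ℝ)) (G.D (inner ℝ) x) x := by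
  refine (G.hasFDerivAt_comp_vec_inner (G.smooth.differentiable (by simp)) x).congr_fderiv ?_
  ext w
  simp [D]

lemma hasFDerivAt_D_inner (x : E) :
    HasFDerivAt (G.D (inner ℝ)) (contractOp (G.D2 (inner ℝ) x)) x := by
  refine (HasFDerivAt.fun_sum fun j _ ↦ (G.hasFDerivAt_comp_vec_inner
    ((contDiff_partialDeriv G.smooth j).differentiable (by simp)) x).smul_const
      (G.φ j)).congr_fderiv ?_
  ext w
  rw [contractOp_D2_apply, Finset.sum_comm]
  simp [Finset.sum_smul, smul_smul]

variable [FiniteDimensional ℝ E] [MeasurableSpace E] [BorelSpace E]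

lemma hasSteinDiscrepancyLE_val_stdGaussian :
    HasSteinDiscrepancyLE (G.val (inner ℝ)) (stdGaussian E)
      (3 / 2 * (lpNorm (fun x ↦ contractOp (G.D2 (inner ℝ) x)) 4 (stdGaussian E)
        * lpNorm (G.D (inner ℝ)) 4 (stdGaussian E))) := by
  obtain ⟨f, hf⟩ := G.exists_val_eq_comp_vec (inner ℝ)
  obtain ⟨g, hg⟩ := G.exists_D_eq_comp_vec (inner ℝ)
  obtain ⟨T, hT⟩ := G.exists_D2_eq_comp_vec (inner ℝ)
  have hval := G.hasGradientAt_val_inner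
  have hD := G.hasFDerivAt_D_inner
  rw [hf, hg] at hval
  rw [hg, hT] at hD
  rw [hf, hg, hT]
  let vec : C(E, Fin G.n → ℝ) := ⟨_, G.continuous_vec_inner⟩
  exact hasSteinDiscrepancyLE_stdGaussian (f := f.compContinuous vec) (g := g.compContinuous vec)
    (A := (T.comp contractOp lipschitzWith_contractOp).compContinuous vec) hval hD

end StandardGaussian

section Isonormal

variable {H Ω : Type*} [NormedAddCommGroup H] [InnerProductSpace ℝ H] (G : Cylinder H)

/-- The cylinder `G`, seen as a cylinder over the span of its directions `φ₁, …, φₙ`. -/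
def restrictSpan : Cylinder (Submodule.span ℝ (Set.range G.φ)) where
  n := G.n
  g := G.g
  φ i := ⟨G.φ i, Submodule.subset_span ⟨i, rfl⟩⟩
  smooth := G.smooth
  compact := G.compact

variable {G} {X : H → Ω → ℝ} {ω : Ω} {y : Submodule.span ℝ (Set.range G.φ)}

lemma coe_D_restrictSpan (h : G.restrictSpan.vec (inner ℝ) y = G.vec X ω) :
    (G.restrictSpan.D (inner ℝ) y : H) = G.D X ω := by
  simp only [D, h, AddSubmonoidClass.coe_finsetSum, SetLike.val_smul]
  rfl

lemma norm_contractOp_D2_restrictSpan_le [CompleteSpace H]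
    [CompleteSpace (Submodule.span ℝ (Set.range G.φ))]
    (h : G.restrictSpan.vec (inner ℝ) y = G.vec X ω) :
    ‖contractOp (G.restrictSpan.D2 (inner ℝ) y)‖ ≤ ‖contractOp (G.D2 X ω)‖ := by
  refine ContinuousLinearMap.opNorm_le_bound _ (norm_nonneg _) fun v ↦ ?_
  have hv : (contractOp (G.restrictSpan.D2 (inner ℝ) y) v : H) = contractOp (G.D2 X ω) v := by
    simp only [contractOp_D2_apply, h, AddSubmonoidClass.coe_finsetSum, SetLike.val_smul]
    rfl
  rw [← Submodule.norm_coe, hv]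
  exact ContinuousLinearMap.le_opNorm _ _

variable [MeasurableSpace Ω] {P : Measure Ω} (G)

lemma memLp_D [IsFiniteMeasure P] (hX : ∀ h, AEMeasurable (X h) P) (p : ℝ≥0∞) :
    MemLp (G.D X) p P := by
  obtain ⟨b, hb⟩ := G.exists_D_eq_comp_vec X
  exact hb ▸ memLp_comp_vec hX b p

lemma memLp_contractOp_D2 [CompleteSpace H] [IsFiniteMeasure P] (hX : ∀ h, AEMeasurable (X h) P)
    (p : ℝ≥0∞) : MemLp (fun ω ↦ contractOp (G.D2 X ω)) p P := by
  obtain ⟨b, hb⟩ := G.exists_D2_eq_comp_vec X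
  exact hb ▸ memLp_comp_vec hX (b.comp contractOp lipschitzWith_contractOp) p

variable [CompleteSpace H]

theorem hasSteinDiscrepancyLE_val (hX : IsIsonormal X P) :
    HasSteinDiscrepancyLE (G.val X) P
      (3 / 2 * (lpNorm (fun ω ↦ contractOp (G.D2 X ω)) 4 P * lpNorm (G.D X) 4 P)) := by
  have := hX.gaussian.isProbabilityMeasure
  let V := Submodule.span ℝ (Set.range G.φ)
  let _ : MeasurableSpace V := borel V
  have : BorelSpace V := ⟨rfl⟩
  have : FiniteDimensional ℝ V := .span_of_finite ℝ (Set.finite_range _)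
  have : CompleteSpace V := FiniteDimensional.complete ℝ V
  have hXm (h : H) : AEMeasurable (X h) P := hX.gaussian.aemeasurable h
  have hY : AEMeasurable (noiseOn V X) P := hX.aemeasurable_noiseOn
  have hvec : ∀ᵐ ω ∂P, G.restrictSpan.vec (inner ℝ) (noiseOn V X ω) = G.vec X ω := by
    filter_upwards [ae_all_iff.2 fun i ↦ hX.ae_inner_noiseOn (G.restrictSpan.φ i)] with ω hω
    exact funext hω
  have hval : IdentDistrib (G.restrictSpan.val (inner ℝ)) (G.val X) (stdGaussian V) P := by
    have hid : IdentDistrib id (noiseOn V X) (stdGaussian V) P :=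
      ⟨aemeasurable_id, hY, by rw [Measure.map_id, hX.map_noiseOn]⟩
    have hcont : Continuous (G.restrictSpan.val (inner ℝ)) :=
      G.restrictSpan.smooth.continuous.comp G.restrictSpan.continuous_vec_inner
    refine (hid.comp hcont.measurable).trans
      (.of_ae_eq (hcont.measurable.comp_aemeasurable hY) ?_)
    exact hvec.mono fun ω hω ↦ congrArg G.g hω
  refine (G.restrictSpan.hasSteinDiscrepancyLE_val_stdGaussian.of_identDistrib hval).mono ?_
  have hmeas (v : V) : AEMeasurable (inner ℝ v) (stdGaussian V) := by fun_prop
  rw [← hX.map_noiseOn] at hmeas ⊢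
  refine mul_le_mul_of_nonneg_left (mul_le_mul ?_ ?_ lpNorm_nonneg lpNorm_nonneg) (by norm_num)
  · refine lpNorm_map_le_of_ae_norm_comp_le hY (memLp_contractOp_D2 _ hmeas 4).1
      (G.memLp_contractOp_D2 hXm 4) ?_
    filter_upwards [hvec] with ω hω
    exact norm_contractOp_D2_restrictSpan_le hω
  · refine lpNorm_map_le_of_ae_norm_comp_le hY (memLp_D _ hmeas 4).1 (G.memLp_D hXm 4) ?_
    filter_upwards [hvec] with ω hω
    rw [← coe_D_restrictSpan hω, Submodule.norm_coe]

end Isonormal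

end Cylinder

/-! ### Passage to the limit -/

section Limit

variable {Ω E : Type*} [MeasurableSpace Ω] {P : Measure Ω} [NormedAddCommGroup E] {p : ℝ≥0∞}

lemma tendsto_lpNorm_of_tendsto_eLpNorm_sub {u : ℕ → Ω → E} {v : Ω → E}
    (hp : 1 ≤ p) (hu : ∀ k, MemLp (u k) p P)
    (hv : MemLp v p P) (huv : Tendsto (fun k ↦ eLpNorm (u k - v) p P) atTop (𝓝 0)) :
    Tendsto (fun k ↦ lpNorm (u k) p P) atTop (𝓝 (lpNorm v p P)) := by
  have : Fact (1 ≤ p) := ⟨hp⟩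
  simpa only [Lp.norm_toLp, toReal_eLpNorm (hu _).1, toReal_eLpNorm hv.1] using
    ((Lp.tendsto_Lp_iff_tendsto_eLpNorm'' u hu v hv).2 huv).norm

lemma tendsto_integral_mul_of_tendsto_eLpNorm_sub {u v : ℕ → Ω → ℝ} {u₀ v₀ : Ω → ℝ}
    (hu : ∀ k, MemLp (u k) 2 P) (hv : ∀ k, MemLp (v k) 2 P) (hu₀ : MemLp u₀ 2 P)
    (hv₀ : MemLp v₀ 2 P) (hut : Tendsto (fun k ↦ eLpNorm (u k - u₀) 2 P) atTop (𝓝 0))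
    (hvt : Tendsto (fun k ↦ eLpNorm (v k - v₀) 2 P) atTop (𝓝 0)) :
    Tendsto (fun k ↦ ∫ ω, (u k * v k) ω ∂P) atTop (𝓝 (∫ ω, (u₀ * v₀) ω ∂P)) := by
  have hinner {a b : Ω → ℝ} (ha : MemLp a 2 P) (hb : MemLp b 2 P) :
      ⟪ha.toLp a, hb.toLp b⟫_ℝ = ∫ ω, (a * b) ω ∂P := by
    rw [L2.inner_def]
    refine integral_congr_ae ?_
    filter_upwards [ha.coeFn_toLp, hb.coeFn_toLp] with ω hω hω'
    simp [hω, hω', mul_comm]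
  simpa only [hinner] using ((Lp.tendsto_Lp_iff_tendsto_eLpNorm'' u hu u₀ hu₀).2 hut).inner
    (𝕜 := ℝ) ((Lp.tendsto_Lp_iff_tendsto_eLpNorm'' v hv v₀ hv₀).2 hvt)

lemma tendsto_covariance_of_tendsto_eLpNorm_sub [IsProbabilityMeasure P] {u v : ℕ → Ω → ℝ}
    {u₀ v₀ : Ω → ℝ} (hu : ∀ k, MemLp (u k) 2 P) (hv : ∀ k, MemLp (v k) 2 P)
    (hu₀ : MemLp u₀ 2 P) (hv₀ : MemLp v₀ 2 P)
    (hut : Tendsto (fun k ↦ eLpNorm (u k - u₀) 2 P) atTop (𝓝 0))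
    (hvt : Tendsto (fun k ↦ eLpNorm (v k - v₀) 2 P) atTop (𝓝 0)) :
    Tendsto (fun k ↦ cov[u k, v k; P]) atTop (𝓝 cov[u₀, v₀; P]) := by
  have hmean {w : ℕ → Ω → ℝ} {w₀ : Ω → ℝ} (hw : ∀ k, MemLp (w k) 2 P) (hw₀ : MemLp w₀ 2 P)
      (hwt : Tendsto (fun k ↦ eLpNorm (w k - w₀) 2 P) atTop (𝓝 0)) :
      Tendsto (fun k ↦ ∫ ω, w k ω ∂P) atTop (𝓝 (∫ ω, w₀ ω ∂P)) := by
    simpa using tendsto_integral_mul_of_tendsto_eLpNorm_sub hw (fun _ ↦ memLp_const 1) hw₀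
      (memLp_const 1) hwt (by simp)
  simp_rw [covariance_eq_sub (hu _) (hv _), covariance_eq_sub hu₀ hv₀]
  exact (tendsto_integral_mul_of_tendsto_eLpNorm_sub hu hv hu₀ hv₀ hut hvt).sub
    ((hmean hu hu₀ hut).mul (hmean hv hv₀ hvt))

lemma tendsto_eLpNorm_comp_sub_of_lipschitzWith {u : ℕ → Ω → ℝ} {v : Ω → ℝ} {h : ℝ → ℝ} {L : ℝ≥0}
    (hL : LipschitzWith L h) (huv : Tendsto (fun k ↦ eLpNorm (u k - v) p P) atTop (𝓝 0)) :
    Tendsto (fun k ↦ eLpNorm (h ∘ u k - h ∘ v) p P) atTop (𝓝 0) := by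
  refine tendsto_of_tendsto_of_tendsto_of_le_of_le tendsto_const_nhds
    (by simpa using ENNReal.Tendsto.const_mul huv (.inr (ENNReal.coe_ne_top (r := L))))
    (fun _ ↦ zero_le) fun k ↦ ?_
  exact eLpNorm_le_nnreal_smul_eLpNorm_of_ae_le_mul (ae_of_all _ fun ω ↦ hL.norm_sub_le _ _) p

lemma tendsto_integral_of_tendstoInDistribution [IsProbabilityMeasure P] {u : ℕ → Ω → ℝ}
    {v : Ω → ℝ} (huv : TendstoInDistribution u atTop v (fun _ ↦ P) P) (b : ℝ →ᵇ ℝ) :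
    Tendsto (fun k ↦ ∫ ω, b (u k ω) ∂P) atTop (𝓝 (∫ ω, b (v ω) ∂P)) := by
  have hmap {w : Ω → ℝ} (hw : AEMeasurable w P) : ∫ x, b x ∂P.map w = ∫ ω, b (w ω) ∂P :=
    integral_map hw b.continuous.aestronglyMeasurable
  simpa only [ProbabilityMeasure.coe_mk, hmap (huv.forall_aemeasurable _),
    hmap huv.aemeasurable_limit] using
    ProbabilityMeasure.tendsto_iff_forall_integral_tendsto.1 huv.tendsto b

lemma HasSteinDiscrepancyLE.of_tendsto [IsProbabilityMeasure P] {G : ℕ → Ω → ℝ} {F : Ω → ℝ}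
    {κ : ℕ → ℝ} {κ₀ : ℝ} (hG : ∀ k, HasSteinDiscrepancyLE (G k) P (κ k))
    (hG2 : ∀ k, MemLp (G k) 2 P) (hF2 : MemLp F 2 P)
    (hGF : Tendsto (fun k ↦ eLpNorm (G k - F) 2 P) atTop (𝓝 0))
    (hκ : Tendsto κ atTop (𝓝 κ₀)) : HasSteinDiscrepancyLE F P κ₀ := by
  intro M h hh hhM
  have hcov : Tendsto (fun k ↦ cov[h ∘ G k, G k; P]) atTop (𝓝 cov[h ∘ F, F; P]) :=
    tendsto_covariance_of_tendsto_eLpNorm_sub (fun k ↦ memLp_comp_of_lipschitzWith hhM (hG2 k))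
      hG2 (memLp_comp_of_lipschitzWith hhM hF2) hF2
      (tendsto_eLpNorm_comp_sub_of_lipschitzWith hhM hGF) hGF
  have hvar : Tendsto (fun k ↦ Var[G k; P]) atTop (𝓝 Var[F; P]) := by
    simpa only [covariance_self (hG2 _).aemeasurable, covariance_self hF2.aemeasurable] using
      tendsto_covariance_of_tendsto_eLpNorm_sub hG2 hG2 hF2 hF2 hGF hGF
  have hderiv : Tendsto (fun k ↦ ∫ ω, deriv h (G k ω) ∂P) atTop (𝓝 (∫ ω, deriv h (F ω) ∂P)) := by
    have hdist := (tendstoInMeasure_of_tendsto_eLpNorm two_ne_zero (fun k ↦ (hG2 k).1) hF2.1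
      hGF).tendstoInDistribution fun k ↦ (hG2 k).aemeasurable
    exact tendsto_integral_of_tendstoInDistribution hdist (.ofNormedAddCommGroup (deriv h)
      (hh.continuous_deriv le_rfl) M fun _ ↦ norm_deriv_le_of_lipschitz hhM)
  exact le_of_tendsto_of_tendsto' (hcov.sub (hvar.mul hderiv)).abs (hκ.const_mul _)
    fun k ↦ hG k M h hh hhM

end Limit

lemma IsMalliavin2.memLp_contractOp {H Ω : Type*} [NormedAddCommGroup H] [InnerProductSpace ℝ H]
    [CompleteSpace H] [MeasurableSpace Ω] {P : Measure Ω} {X : H → Ω → ℝ} {p : ℝ≥0∞} {F : Ω → ℝ}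
    {DF : Ω → H} {D2F : Ω → HTensor H} (hF : IsMalliavin2 X P p F DF D2F) :
    MemLp (fun ω ↦ contractOp (D2F ω)) p P :=
  hF.memLp_D2.of_le (lipschitzWith_contractOp.continuous.comp_aestronglyMeasurable hF.memLp_D2.1)
    (ae_of_all _ fun _ ↦ norm_contractOp_le _)

theorem IsMalliavin2.hasSteinDiscrepancyLE {H Ω : Type*} [NormedAddCommGroup H]
    [InnerProductSpace ℝ H] [CompleteSpace H] [MeasurableSpace Ω] {P : Measure Ω}
    {X : H → Ω → ℝ} {F : Ω → ℝ} {DF : Ω → H} {D2F : Ω → HTensor H} (hX : IsIsonormal X P)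
    (hF : IsMalliavin2 X P 4 F DF D2F) : HasSteinDiscrepancyLE F P
      (3 / 2 * (lpNorm (fun ω ↦ contractOp (D2F ω)) 4 P * lpNorm DF 4 P)) := by
  have := hX.gaussian.isProbabilityMeasure
  have hXm (h : H) : AEMeasurable (X h) P := hX.gaussian.aemeasurable h
  obtain ⟨G, hGF, hDG, hD2G⟩ := hF.exists_seq
  have hGF2 : Tendsto (fun k ↦ eLpNorm ((G k).val X - F) 2 P) atTop (𝓝 0) :=
    tendsto_of_tendsto_of_tendsto_of_le_of_le tendsto_const_nhds hGF (fun _ ↦ zero_le) fun k ↦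
      eLpNorm_le_eLpNorm_of_exponent_le (by norm_num)
        (((G k).memLp_val hXm 4).sub hF.memLp).aestronglyMeasurable
  have hop : Tendsto (fun k ↦ eLpNorm ((fun ω ↦ contractOp ((G k).D2 X ω))
      - fun ω ↦ contractOp (D2F ω)) 4 P) atTop (𝓝 0) := by
    refine tendsto_of_tendsto_of_tendsto_of_le_of_le tendsto_const_nhds hD2G (fun _ ↦ zero_le)
      fun k ↦ eLpNorm_mono fun ω ↦ ?_
    rw [Pi.sub_apply, ← contractOp_sub]
    exact norm_contractOp_le _
  have h14 : (1 : ℝ≥0∞) ≤ 4 := by norm_num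
  exact .of_tendsto (fun k ↦ (G k).hasSteinDiscrepancyLE_val hX)
    (fun k ↦ (G k).memLp_val hXm 2) (hF.memLp.mono_exponent (by norm_num)) hGF2
    (((tendsto_lpNorm_of_tendsto_eLpNorm_sub h14 (fun k ↦ (G k).memLp_contractOp_D2 hXm 4)
      hF.memLp_contractOp hop).mul (tendsto_lpNorm_of_tendsto_eLpNorm_sub h14
        (fun k ↦ (G k).memLp_D hXm 4) hF.memLp_D hDG)).const_mul _)

lemma lintegral_enorm_pow_four_rpow_eq_ofReal_lpNorm {Ω E : Type*} [MeasurableSpace Ω]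
    {P : Measure Ω} [NormedAddCommGroup E] {f : Ω → E} (hf : MemLp f 4 P) :
    (∫⁻ ω, ‖f ω‖ₑ ^ 4 ∂P) ^ (1 / 4 : ℝ) = .ofReal (lpNorm f 4 P) := by
  rw [ofReal_lpNorm hf, eLpNorm_eq_lintegral_rpow_enorm_toReal (by norm_num) (by norm_num)]
  simp only [ENNReal.toReal_ofNat, ENNReal.rpow_ofNat]

end Malliavin

theorem theorem1p1_general {H Ω : Type*} [NormedAddCommGroup H] [InnerProductSpace ℝ H]
    [CompleteSpace H] [MeasurableSpace Ω] (P : Measure Ω)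
    (X : H → Ω → ℝ) (hX : Malliavin.IsIsonormal X P)
    (F : Ω → ℝ) (DF : Ω → H) (D2F : Ω → Malliavin.HTensor H)
    (hF : Malliavin.IsMalliavin2 X P 4 F DF D2F)
    (μ σ : ℝ) (hσ : 0 < σ) (hmean : ∫ ω, F ω ∂P = μ) (hvar : variance F P = σ ^ 2) :
    Malliavin.wassersteinDist (P.map F) (gaussianReal μ (σ ^ 2).toNNReal) ≤
        ENNReal.ofReal (3 / (2 * σ))
          * (∫⁻ ω, ‖Malliavin.contractOp (D2F ω)‖ₑ ^ 4 ∂P) ^ (1 / 4 : ℝ)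
          * (∫⁻ ω, ‖DF ω‖ₑ ^ 4 ∂P) ^ (1 / 4 : ℝ) ∧
      Malliavin.tvDist (P.map F) (gaussianReal μ (σ ^ 2).toNNReal) ≤
        ENNReal.ofReal (3 / σ ^ 2)
          * (∫⁻ ω, ‖Malliavin.contractOp (D2F ω)‖ₑ ^ 4 ∂P) ^ (1 / 4 : ℝ)
          * (∫⁻ ω, ‖DF ω‖ₑ ^ 4 ∂P) ^ (1 / 4 : ℝ) := by
  have := hX.gaussian.isProbabilityMeasure
  have hF2 : MemLp F 2 P := hF.memLp.mono_exponent (by norm_num)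
  have hstein := hF.hasSteinDiscrepancyLE hX
  rw [Malliavin.lintegral_enorm_pow_four_rpow_eq_ofReal_lpNorm hF.memLp_contractOp,
    Malliavin.lintegral_enorm_pow_four_rpow_eq_ofReal_lpNorm hF.memLp_D,
    ← ENNReal.ofReal_mul (by positivity),
    ← ENNReal.ofReal_mul (mul_nonneg (by positivity) lpNorm_nonneg),
    ← ENNReal.ofReal_mul (by positivity),
    ← ENNReal.ofReal_mul (mul_nonneg (by positivity) lpNorm_nonneg)]
  refine ⟨(hstein.wassersteinDist_le hF2 hσ hmean hvar).trans_eq (congrArg _ ?_),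
    (hstein.tvDist_le hF2 hσ hmean hvar).trans_eq (congrArg _ ?_)⟩ <;> field

theorem theorem1p1 {H Ω Ω' : Type*} [NormedAddCommGroup H] [InnerProductSpace ℝ H]
    [CompleteSpace H] [TopologicalSpace.SeparableSpace H]
    [MeasurableSpace Ω] (P : Measure Ω) [IsProbabilityMeasure P]
    [MeasurableSpace Ω'] (P' : Measure Ω') [IsProbabilityMeasure P']
    (X : H → Ω → ℝ) (hX : Malliavin.IsIsonormal X P)
    (F : Ω → ℝ) (DF : Ω → H) (D2F : Ω → Malliavin.HTensor H)
    (hF : Malliavin.IsMalliavin2 X P 4 F DF D2F)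
    (μ σ : ℝ) (hσ : 0 < σ) (hmean : ∫ ω, F ω ∂P = μ) (hvar : variance F P = σ ^ 2)
    (Z : Ω' → ℝ) (hZ : HasLaw Z (gaussianReal μ (σ ^ 2).toNNReal) P') :
    Malliavin.wassersteinDist (P.map F) (P'.map Z) ≤
        ENNReal.ofReal (√10 / (2 * σ))
          * (∫⁻ ω, ‖Malliavin.contractOp (D2F ω)‖ₑ ^ 4 ∂P) ^ (1 / 4 : ℝ)
          * (∫⁻ ω, ‖DF ω‖ₑ ^ 4 ∂P) ^ (1 / 4 : ℝ) ∧
      (P.map F ≪ volume →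
        Malliavin.tvDist (P.map F) (P'.map Z) ≤
          ENNReal.ofReal (√10 / σ ^ 2)
            * (∫⁻ ω, ‖Malliavin.contractOp (D2F ω)‖ₑ ^ 4 ∂P) ^ (1 / 4 : ℝ)
            * (∫⁻ ω, ‖DF ω‖ₑ ^ 4 ∂P) ^ (1 / 4 : ℝ)) := by
  have h10 : (3 : ℝ) ≤ √10 := Real.le_sqrt_of_sq_le (by norm_num)
  obtain ⟨hW, hTV⟩ := theorem1p1_general P X hX F DF D2F hF μ σ hσ hmean hvar
  rw [hZ.map_eq]
  exact ⟨hW.trans (by gcongr), fun _ ↦ hTV.trans (by gcongr)⟩
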